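/- Let $\mathsf T$ be a compactly generated triangulated category with suspension $\Sigma$: $\mathsf T$ has all small coproducts, its full subcategory $\mathsf T^c$ of compact objects (those $C$ for which $\operatorname{Hom}(C,-)$ preserves coproducts) is essentially small, and an object $X$ with $\operatorname{Hom}(C,X)=0$ for all compact $C$ is zero. Let $\operatorname{Mod}\mathsf T^c$ be the category of contravariant additive functors $\mathsf T^c\to\mathrm{Ab}$ and let $H_{\mathsf T}\colon\mathsf T\to\operatorname{Mod}\mathsf T^c$, $H_{\mathsf T}X=\operatorname{Hom}(-,X)|_{\mathsf T^c}$, be the restricted Yoneda functor. A morphism $f$ of $\mathsf T$ is a pure-monomorphism if $H_{\mathsf T}f$ is a monomorphism, and an object $Y$ is pure-injective if every pure-monomorphism $Y\to X$ splits. Let $\mathsf L\subseteq\mathsf T$ be a localizing subcategory, that is, a strictly full triangulated subcategory closed under small coproducts. Then the following are equivalent. 1. $\mathsf L$ is cohomological: there are an abelian category $\mathsf A$ which is cocomplete with exact filtered colimits (that is, (AB5)) and an additive functor $H\colon\mathsf T\to\mathsf A$ which sends triangles to long exact sequences and preserves all coproducts, such that $$\mathsf L=\{X\in\mathsf T\mid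 H(\Sigma^nX)=0\text{ for all }n\in\mathbb Z\}.$$ 2. There is a suspension stable collection $(Y_i)_{i\in I}$ of pure-injective objects of $\mathsf T$ (that is, for all $i\in I$ and $n\in\mathbb Z$ the object $\Sigma^nY_i$ is isomorphic to some $Y_j$) such that $$\mathsf L=\{X\in\mathsf T\mid\operatorname{Hom}(X,Y_i)=0\text{ for all }i\in I\}.$$ -/

import Mathlib

open CategoryTheory CategoryTheory.Limits

universe t w v u

noncomputable section

namespace TriangulatedPurity

variable (T : Type u) [Category.{v} T] [Preadditive T]

/-- The compact objects of `T`: those `C` such that the functor `Hom(C, -) : T ⥤ Ab` preserves all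
small coproducts. -/
def compactObjects : ObjectProperty T := fun C ↦
  ∀ J : Type v, PreservesColimitsOfShape (Discrete J) (preadditiveCoyoneda.obj (Opposite.op C))

/-- The full subcategory `T^c` of compact objects. -/
abbrev Compacts : Type u := (compactObjects T).FullSubcategory

/-- `Mod T^c`: the category of contravariant additive functors from `T^c` to abelian groups. -/
abbrev ModCompacts := (Compacts T)ᵒᵖ ⥤+ AddCommGrpCat.{v}

/-- The restricted Yoneda functor `H : T ⥤ Mod T^c`, `H X = Hom(-, X)|_{T^c}`. -/
def restrictedYoneda : T ⥤ ModCompacts T :=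
  ObjectProperty.lift _
    (preadditiveYoneda ⋙ (Functor.whiskeringLeft _ _ _).obj (compactObjects T).ι.op)
    (fun X ↦ inferInstanceAs ((compactObjects T).ι.op ⋙ preadditiveYoneda.obj X).Additive)

variable {T}

/-- A morphism `f` is a pure-monomorphism if `H f` is a monomorphism in `Mod T^c`. -/
def IsPureMono {X Y : T} (f : X ⟶ Y) : Prop := Mono ((restrictedYoneda T).map f)

/-- An object `I` is pure-injective if every pure-monomorphism `I ⟶ X` is split. -/
def IsPureInjective (I : T) : Prop :=
  ∀ ⦃X : T⦄ (f : I ⟶ X), IsPureMono f → IsSplitMono f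

variable (T) [HasZeroObject T] [HasShift T ℤ] [∀ n : ℤ, (shiftFunctor T n).Additive]
  [Pretriangulated T]

/-- A triangulated category is compactly generated if it has all small coproducts, the compact
objects form a set up to isomorphism, and an object that receives no nonzero morphism from a
compact object is zero. -/
structure IsCompactlyGenerated : Prop where
  hasCoproducts : HasCoproducts.{v} T
  essentiallySmall : ObjectProperty.EssentiallySmall.{v} (compactObjects T)
  isZero_of_forall_eq_zero : ∀ X : T,
    (∀ C : T, compactObjects T C → ∀ f : C ⟶ X, f = 0) → IsZero X

variable {T}

/-- A (strictly full) subcategory is localizing if it is triangulated and closed under all small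
coproducts. -/
structure IsLocalizing (L : ObjectProperty T) : Prop where
  closedUnderIso : L.IsClosedUnderIsomorphisms
  triangulated : L.IsTriangulated
  closedUnderCoproducts : ∀ J : Type v, L.IsClosedUnderColimitsOfShape (Discrete J)

/-- A subcategory `L` is cohomological if there is a covariant exact ("cohomological", in Mathlib
`Functor.IsHomological`) functor `H` from `T` to an (AB5) abelian category that preserves all
small coproducts and satisfies `L = {X | H (Σ ^ n X) = 0 for all n : ℤ}`. The (AB5) category is
not required to have a generator. -/
def IsCohomological (L : ObjectProperty T) : Prop :=
  ∃ (A : Type max w (v + 1)) (_ : Category.{v} A) (_ : Abelian A)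
    (_ : HasColimitsOfSize.{v, v} A) (_ : AB5 A) (H : T ⥤ A),
    H.IsHomological ∧
    (∀ J : Type v, PreservesColimitsOfShape (Discrete J) H) ∧
    ∀ X : T, L X ↔ ∀ n : ℤ, IsZero (H.obj ((shiftFunctor T n).obj X))

/-- A family of objects is suspension stable if, up to isomorphism, it is closed under all
positive and negative powers of the suspension. -/
def IsSuspensionStable {I : Type t} (Y : I → T) : Prop :=
  ∀ (i : I) (n : ℤ), ∃ j : I, Nonempty (Y j ≅ (shiftFunctor T n).obj (Y i))

end TriangulatedPurity

end

/-! Both directions pass through sheaves on a small full model `i : C ⥤ T` of the compact objects.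
For any topology on `C`, sheafifying `X ↦ Hom(i -, X)` gives a homological, coproduct-preserving
functor `homSheaf` to a Grothendieck category. It kills `X` exactly when every map `i c ⟶ X` has a
covering annihilator sieve (`isZero_homSheaf_obj_iff`).

Given pure-injectives `Y k`, call a sieve covering if it and all its pullbacks detect vanishing of
maps to the `Y k`. Such maps are detected on compact objects (`IsPureInjective.eq_zero_of_phantom`)
and extend whenever annihilators allow it (`IsPureInjective.exists_extension`), so the sheaf of `X`
vanishes if and only if every `X ⟶ Y k` does.

Given `H : T ⥤ A`, the category `A` may lack a generator, hence an injective cogenerator. It is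
replaced by sheaves for the topology of sieves whose images under `H`, after every pullback, are
jointly epimorphic. No object is gained or lost in the kernel, because `H X` is locally generated by
values of `H` on compact objects, with relations also coming from compact objects: both properties
pass to cones and, by (AB5), to coproducts, so they reach all of `T`. An injective cogenerator `E`
of sheaves and Brown representability then give `Y` with `Hom(X, Y) ≅ Hom(G X, E)`, where `G` is
`homSheaf`. As `G` sends pure-monomorphisms to monomorphisms, `Y` is pure-injective; its suspensions
form the required family. -/

noncomputable section

namespace TriangulatedPurity

open Pretriangulated Opposite
open scoped Classical ZeroObject

/-! ### Compactness as factorization through finite subcoproducts -/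

section Proj

variable {T : Type u} [Category.{v} T] [Preadditive T] [HasCoproducts.{v} T]
  {J : Type v} (X : J → T)

/-- The projection of a coproduct onto the part indexed by a finite set, as an endomorphism. -/
def sigmaProj (s : Finset J) : ∐ X ⟶ ∐ X := ∑ j ∈ s, Sigma.π X j ≫ Sigma.ι X j

variable {X}

lemma ι_sigmaProj_of_mem {s : Finset J} {j : J} (hj : j ∈ s) :
    Sigma.ι X j ≫ sigmaProj X s = Sigma.ι X j := by
  rw [sigmaProj, Preadditive.comp_sum, Finset.sum_eq_single j]
  · simp
  · intro k _ hk
    rw [Sigma.ι_π_of_ne_assoc X hk.symm, zero_comp]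
  · exact fun h ↦ (h hj).elim

lemma ι_sigmaProj_of_notMem {s : Finset J} {j : J} (hj : j ∉ s) :
    Sigma.ι X j ≫ sigmaProj X s = 0 := by
  rw [sigmaProj, Preadditive.comp_sum]
  refine Finset.sum_eq_zero fun k hk ↦ ?_
  rw [Sigma.ι_π_of_ne_assoc X (fun h : j = k ↦ hj (h ▸ hk)), zero_comp]

lemma sigmaProj_comp_of_subset {s s' : Finset J} (h : s ⊆ s') :
    sigmaProj X s ≫ sigmaProj X s' = sigmaProj X s := by
  refine Sigma.hom_ext _ _ fun j ↦ ?_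
  by_cases hj : j ∈ s
  · rw [← Category.assoc, ι_sigmaProj_of_mem hj, ι_sigmaProj_of_mem (h hj)]
  · rw [← Category.assoc, ι_sigmaProj_of_notMem hj, zero_comp]

lemma comp_sigmaProj_of_subset {C : T} {f : C ⟶ ∐ X} {s s' : Finset J} (h : s ⊆ s')
    (hf : f ≫ sigmaProj X s = f) : f ≫ sigmaProj X s' = f := by
  rw [← hf, Category.assoc, sigmaProj_comp_of_subset h]

lemma comp_sigmaProj_eq_self_of_comp {C D : T} {g : D ⟶ C} {f : C ⟶ ∐ X} {s : Finset J}
    (hf : f ≫ sigmaProj X s = f) : (g ≫ f) ≫ sigmaProj X s = g ≫ f := by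
  rw [Category.assoc, hf]

lemma comp_π_eq_zero {C : T} {f : C ⟶ ∐ X} {s : Finset J} (hf : f ≫ sigmaProj X s = f)
    {j : J} (hj : j ∉ s) : f ≫ Sigma.π X j = 0 := by
  rw [← hf, sigmaProj, Preadditive.comp_sum, Preadditive.sum_comp]
  refine Finset.sum_eq_zero fun k hk ↦ ?_
  rw [Category.assoc, Category.assoc, Sigma.ι_π_of_ne X (fun h : k = j ↦ hj (h ▸ hk)), comp_zero,
    comp_zero]

lemma eq_sum_of_comp_sigmaProj [inst : DecidableEq J] {C : T} {f : C ⟶ ∐ X} {s : Finset J}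
    (hf : f ≫ sigmaProj X s = f) : f = ∑ j ∈ s, (f ≫ Sigma.π X j) ≫ Sigma.ι X j := by
  obtain rfl : inst = fun a b ↦ Classical.propDecidable (a = b) := Subsingleton.elim _ _
  conv_lhs => rw [← hf, sigmaProj, Preadditive.comp_sum]
  simp

/-- An object is finitary if every morphism from it to a coproduct factors through a finite
subcoproduct. -/
def IsFinitary (C : T) : Prop :=
  ∀ (J : Type v) (X : J → T) (f : C ⟶ ∐ X), ∃ s : Finset J, f ≫ sigmaProj X s = f

variable (X) in
/-- The morphisms into a coproduct that factor through a finite subcoproduct. -/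
def finiteHoms (C : T) : AddSubgroup (C ⟶ ∐ X) where
  carrier := {f | ∃ s : Finset J, f ≫ sigmaProj X s = f}
  zero_mem' := ⟨∅, by simp⟩
  add_mem' := by
    rintro f g ⟨s, hs⟩ ⟨s', hs'⟩
    exact ⟨s ∪ s', by rw [Preadditive.add_comp,
      comp_sigmaProj_of_subset Finset.subset_union_left hs,
      comp_sigmaProj_of_subset Finset.subset_union_right hs']⟩
  neg_mem' := by
    rintro f ⟨s, hs⟩
    exact ⟨s, by rw [Preadditive.neg_comp, hs]⟩

lemma comp_ι_mem_finiteHoms {C : T} {j : J} (g : C ⟶ X j) :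
    g ≫ Sigma.ι X j ∈ finiteHoms X C :=
  ⟨{j}, by rw [Category.assoc, ι_sigmaProj_of_mem (Finset.mem_singleton_self j)]⟩

/-- The quotient map by `finiteHoms` vanishes on the image of every `Hom(C, X j)`. These images are
jointly epimorphic when `Hom(C, -)` preserves the coproduct, so the quotient map is zero. -/
lemma isFinitary_of_compactObjects {C : T} (hC : compactObjects T C) : IsFinitary C := by
  intro J X f
  have := hC J
  let hc := isColimitOfPreserves (preadditiveCoyoneda.obj (op C))
    (colimit.isColimit (Discrete.functor X))
  let q : (preadditiveCoyoneda.obj (op C)).obj (∐ X) ⟶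
      AddCommGrpCat.of ((C ⟶ ∐ X) ⧸ finiteHoms X C) :=
    AddCommGrpCat.ofHom (QuotientAddGroup.mk' (finiteHoms X C))
  have hq : q = 0 := by
    refine hc.hom_ext fun ⟨j⟩ ↦ ?_
    ext (g : C ⟶ X j)
    exact (QuotientAddGroup.eq_zero_iff _).2 (comp_ι_mem_finiteHoms g)
  have : q f = 0 := by rw [hq]; rfl
  exact (QuotientAddGroup.eq_zero_iff _).1 this

lemma compactObjects_of_isFinitary {C : T} (hC : IsFinitary C) : compactObjects T C := by
  intro J
  suffices ∀ X : J → T, PreservesColimit (Discrete.functor X)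
    (preadditiveCoyoneda.obj (op C)) from preservesColimitsOfShape_of_discrete _
  intro X
  refine preservesColimit_of_preserves_colimit_cocone (colimit.isColimit (Discrete.functor X)) ?_
  let φ (c : Cocone (Discrete.functor X ⋙ preadditiveCoyoneda.obj (op C))) (j : J) :
      (C ⟶ X j) →+ c.pt := (c.ι.app ⟨j⟩).hom
  have supp (c : Cocone (Discrete.functor X ⋙ preadditiveCoyoneda.obj (op C))) {f : C ⟶ ∐ X}
      {s : Finset J} (hs : f ≫ sigmaProj X s = f) :
      (Function.support fun j ↦ φ c j (f ≫ Sigma.π X j)) ⊆ s := by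
    intro j hj
    by_contra h
    exact hj (by dsimp only; rw [comp_π_eq_zero hs h, map_zero])
  have fin (c : Cocone (Discrete.functor X ⋙ preadditiveCoyoneda.obj (op C))) (f : C ⟶ ∐ X) :
      (Function.support fun j ↦ φ c j (f ≫ Sigma.π X j)).Finite := by
    obtain ⟨s, hs⟩ := hC J X f
    exact s.finite_toSet.subset (supp c hs)
  -- Only finitely many components of `f` are nonzero, so a cocone descends by summing its values on
  -- them.
  refine
    { desc c := AddCommGrpCat.ofHom (AddMonoidHom.mk'
        (fun f : C ⟶ ∐ X ↦ ∑ᶠ j, φ c j (f ≫ Sigma.π X j)) ?_)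
      fac c := ?_
      uniq c m hm := ?_ }
  · intro (f : C ⟶ ∐ X) (g : C ⟶ ∐ X)
    change ∑ᶠ j, φ c j ((f + g) ≫ Sigma.π X j) = _
    rw [← finsum_add_distrib (fin c f) (fin c g)]
    exact finsum_congr fun j ↦ by rw [Preadditive.add_comp, map_add]
  · rintro ⟨j⟩
    ext (g : C ⟶ X j)
    change ∑ᶠ k, φ c k ((g ≫ Sigma.ι X j) ≫ Sigma.π X k) = φ c j g
    rw [finsum_eq_single _ j]
    · simp
    · intro k hk
      rw [Category.assoc, Sigma.ι_π_of_ne X hk.symm, comp_zero, map_zero]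
  · ext (f : C ⟶ ∐ X)
    let m' : (C ⟶ ∐ X) →+ c.pt := m.hom
    change m' f = ∑ᶠ j, φ c j (f ≫ Sigma.π X j)
    obtain ⟨s, hs⟩ := hC J X f
    rw [finsum_eq_sum_of_support_subset _ (supp c hs)]
    conv_lhs => rw [eq_sum_of_comp_sigmaProj hs]
    rw [map_sum]
    refine Finset.sum_congr rfl fun j _ ↦ ?_
    exact (ConcreteCategory.congr_hom (hm ⟨j⟩) _)

lemma IsFinitary.of_iso {C D : T} (hC : IsFinitary C) (e : C ≅ D) : IsFinitary D := by
  intro J X f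
  obtain ⟨s, hs⟩ := hC J X (e.hom ≫ f)
  exact ⟨s, by rw [← cancel_epi e.hom, ← hs, Category.assoc]⟩

lemma IsFinitary.shift [HasShift T ℤ] [∀ n : ℤ, (shiftFunctor T n).Additive] {C : T}
    (hC : IsFinitary C) (n : ℤ) : IsFinitary (C⟦n⟧) := by
  intro J X f
  let S := shiftFunctor T (-n)
  let σ := sigmaComparison S X
  let g : C ⟶ ∐ fun j ↦ S.obj (X j) :=
    ((shiftFunctorCompIsoId T n (-n) (add_neg_cancel n)).inv.app C ≫ S.map f) ≫ inv σ
  obtain ⟨s, hs⟩ := hC J _ g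
  have key : sigmaProj (fun j ↦ S.obj (X j)) s ≫ σ = σ ≫ S.map (sigmaProj X s) := by
    refine Sigma.hom_ext _ _ fun j ↦ ?_
    by_cases hj : j ∈ s
    · rw [← Category.assoc, ι_sigmaProj_of_mem hj, ι_comp_sigmaComparison,
        ι_comp_sigmaComparison_assoc, ← S.map_comp, ι_sigmaProj_of_mem hj]
    · rw [← Category.assoc, ι_sigmaProj_of_notMem hj, zero_comp,
        ι_comp_sigmaComparison_assoc, ← S.map_comp, ι_sigmaProj_of_notMem hj, S.map_zero]
  refine ⟨s, S.map_injective ?_⟩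
  have hs' := hs =≫ σ
  rw [Category.assoc, key] at hs'
  rw [← cancel_epi ((shiftFunctorCompIsoId T n (-n) (add_neg_cancel n)).inv.app C)]
  simpa [g] using hs'

end Proj

/-! ### Exactness of triangles and closure of finitary objects -/

section Distinguished

variable {T : Type u} [Category.{v} T] [Preadditive T] [HasZeroObject T] [HasShift T ℤ]
  [∀ n : ℤ, (shiftFunctor T n).Additive] [Pretriangulated T] {X Y Z : T} {f : X ⟶ Y} {g : Y ⟶ Z}
  {h : Z ⟶ X⟦(1 : ℤ)⟧} (hD : Triangle.mk f g h ∈ distTriang T)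

include hD

lemma distTriang_comp₁₂ : f ≫ g = 0 := comp_distTriang_mor_zero₁₂ _ hD

lemma distTriang_comp₃₁ : h ≫ f⟦(1 : ℤ)⟧' = 0 := comp_distTriang_mor_zero₃₁ _ hD

lemma distTriang_lift₂ {W : T} (φ : W ⟶ Y) (hφ : φ ≫ g = 0) : ∃ ψ : W ⟶ X, φ = ψ ≫ f :=
  Triangle.coyoneda_exact₂ _ hD φ hφ

lemma distTriang_lift₃ {W : T} (φ : W ⟶ Z) (hφ : φ ≫ h = 0) : ∃ ψ : W ⟶ Y, φ = ψ ≫ g :=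
  Triangle.coyoneda_exact₃ _ hD φ hφ

lemma distTriang_lift₁ {W : T} (φ : W ⟶ X⟦(1 : ℤ)⟧) (hφ : φ ≫ f⟦(1 : ℤ)⟧' = 0) :
    ∃ ψ : W ⟶ Z, φ = ψ ≫ h :=
  Triangle.coyoneda_exact₁ _ hD φ hφ

lemma distTriang_desc₂ {W : T} (φ : Y ⟶ W) (hφ : f ≫ φ = 0) : ∃ ψ : Z ⟶ W, φ = g ≫ ψ :=
  Triangle.yoneda_exact₂ _ hD φ hφ

lemma distTriang_rotate : Triangle.mk g h (-f⟦(1 : ℤ)⟧') ∈ distTriang T :=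
  rot_of_distTriang _ hD

end Distinguished

section Triangulated

variable {T : Type u} [Category.{v} T] [Preadditive T] [HasZeroObject T] [HasShift T ℤ]
  [∀ n : ℤ, (shiftFunctor T n).Additive] [Pretriangulated T] [HasCoproducts.{v} T]

/-- A hands-on five lemma: after subtracting a finite sum, `f` vanishes on `D.obj₂`, so it factors
through the suspension of `D.obj₁`. -/
lemma IsFinitary.cone {D : Triangle T} (hD : D ∈ distTriang T) (h₁ : IsFinitary D.obj₁)
    (h₂ : IsFinitary D.obj₂) : IsFinitary D.obj₃ := by
  intro J X f
  change f ∈ finiteHoms X D.obj₃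
  obtain ⟨s, hs⟩ := h₂ J X (D.mor₂ ≫ f)
  have hj (j : J) : ∃ h : D.obj₃ ⟶ X j, (D.mor₂ ≫ f) ≫ Sigma.π X j = D.mor₂ ≫ h :=
    D.yoneda_exact₂ hD _ (by
      rw [Category.assoc, comp_distTriang_mor_zero₁₂_assoc _ hD, zero_comp])
  choose h hh using hj
  have hz : D.mor₂ ≫ (f - ∑ j ∈ s, h j ≫ Sigma.ι X j) = 0 := by
    rw [Preadditive.comp_sub, sub_eq_zero]
    conv_lhs => rw [← hs, sigmaProj, Preadditive.comp_sum]
    rw [Preadditive.comp_sum]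
    refine Finset.sum_congr rfl fun j _ ↦ ?_
    rw [← Category.assoc, hh, Category.assoc]
  obtain ⟨k, hk⟩ := D.yoneda_exact₃ hD _ hz
  obtain ⟨s', hs'⟩ := h₁.shift 1 J X k
  rw [← sub_add_cancel f (∑ j ∈ s, h j ≫ Sigma.ι X j), hk]
  refine add_mem ⟨s', comp_sigmaProj_eq_self_of_comp hs'⟩ (sum_mem fun j _ ↦ ?_)
  exact comp_ι_mem_finiteHoms _

lemma IsFinitary.fiber {D : Triangle T} (hD : D ∈ distTriang T) (h₂ : IsFinitary D.obj₂)
    (h₃ : IsFinitary D.obj₃) : IsFinitary D.obj₁ :=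
  ((h₂.cone (rot_of_distTriang _ hD) h₃).shift (-1)).of_iso
    ((shiftFunctorCompIsoId T 1 (-1) (add_neg_cancel 1)).app D.obj₁)

lemma IsFinitary.biprod {C D : T} [HasBinaryBiproduct C D] (hC : IsFinitary C)
    (hD : IsFinitary D) : IsFinitary (C ⊞ D) :=
  IsFinitary.fiber (rot_of_distTriang _ (binaryBiproductTriangle_distinguished C D)) hD
    (hC.shift 1)

end Triangulated

/-! ### Telescopes and Brown representability -/

section

variable {T : Type u} [Category.{v} T] (F : Tᵒᵖ ⥤ AddCommGrpCat.{v}) {X Y Z : T}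

lemma map_comp_op_apply (f : X ⟶ Y) (g : Y ⟶ Z) (z : F.obj (op Z)) :
    F.map (f ≫ g).op z = F.map f.op (F.map g.op z) := by
  rw [op_comp, F.map_comp]
  rfl

lemma map_id_op_apply (x : F.obj (op X)) : F.map (𝟙 X).op x = x := by
  rw [op_id, F.map_id]
  rfl

lemma map_sub_op_apply [Preadditive T] [F.Additive] (f g : X ⟶ Y) (y : F.obj (op Y)) :
    F.map (f - g).op y = F.map f.op y - F.map g.op y := by
  rw [show (f - g).op = f.op - g.op from rfl, F.map_sub]
  rfl

end

section Sequence

variable {T : Type u} [Category.{v} T] [Preadditive T] [HasCoproducts.{v} T]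

variable (X : ℕ → T) (f : ∀ n, X n ⟶ X (n + 1))

/-- The terms of a sequence, indexed by a lift of the natural numbers. -/
abbrev seqObj (n : ULift.{v} ℕ) : T := X n.down

/-- The endomorphism `1 - shift` of the coproduct of a sequence. -/
def oneSubShift : ∐ seqObj X ⟶ ∐ seqObj X :=
  Sigma.desc fun n ↦ Sigma.ι (seqObj X) n - f n.down ≫ Sigma.ι (seqObj X) ⟨n.down + 1⟩

lemma oneSubShift_π_zero :
    oneSubShift X f ≫ Sigma.π (seqObj X) ⟨0⟩ = Sigma.π (seqObj X) ⟨0⟩ := by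
  refine Sigma.hom_ext _ _ fun n ↦ ?_
  rw [oneSubShift, colimit.ι_desc_assoc]
  dsimp
  rw [Preadditive.sub_comp, Category.assoc, Sigma.ι_π_of_ne (seqObj X) (b := ⟨n.down + 1⟩)
    (c := ⟨0⟩) (by simp), comp_zero, sub_zero]

lemma oneSubShift_π_succ (m : ℕ) :
    oneSubShift X f ≫ Sigma.π (seqObj X) ⟨m + 1⟩ =
      Sigma.π (seqObj X) ⟨m + 1⟩ - Sigma.π (seqObj X) ⟨m⟩ ≫ f m := by
  refine Sigma.hom_ext _ _ fun n ↦ ?_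
  rw [oneSubShift, colimit.ι_desc_assoc]
  dsimp
  rw [Preadditive.sub_comp, Category.assoc, Preadditive.comp_sub]
  congr 1
  by_cases h : n.down = m
  · obtain ⟨n⟩ := n
    obtain rfl : n = m := h
    rw [Sigma.ι_π_eq_id, Sigma.ι_π_eq_id_assoc, Category.comp_id]
  · rw [Sigma.ι_π_of_ne (seqObj X) (b := ⟨n.down + 1⟩) (c := ⟨m + 1⟩) (by simpa using h),
      Sigma.ι_π_of_ne_assoc (seqObj X) (b := n) (c := ⟨m⟩) (fun h' ↦ h (by rw [h'])),
      comp_zero, zero_comp]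

/-- The components of `ψ` vanish one after the other, starting at index `0`. Finitariness is needed
because projections from a coproduct detect zero only inside finite subcoproducts. -/
lemma eq_zero_of_comp_oneSubShift {C : T} (hC : IsFinitary C) (ψ : C ⟶ ∐ seqObj X)
    (h : ψ ≫ oneSubShift X f = 0) : ψ = 0 := by
  have key (n : ℕ) : ψ ≫ Sigma.π (seqObj X) ⟨n⟩ = 0 := by
    induction n with
    | zero => rw [← oneSubShift_π_zero X f, ← Category.assoc, h, zero_comp]
    | succ n ih =>
      have := h =≫ Sigma.π (seqObj X) ⟨n + 1⟩
      rwa [Category.assoc, oneSubShift_π_succ, zero_comp, Preadditive.comp_sub,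
        ← Category.assoc ψ, ih, zero_comp, sub_zero] at this
  obtain ⟨s, hs⟩ := hC _ _ ψ
  rw [eq_sum_of_comp_sigmaProj hs]
  exact Finset.sum_eq_zero fun n _ ↦ by rw [key n.down, zero_comp]

lemma eq_zero_of_comp_oneSubShift_shift [HasShift T ℤ]
    [∀ n : ℤ, (shiftFunctor T n).Additive] {C : T} (hC : IsFinitary C)
    (ψ : C ⟶ (∐ seqObj X)⟦(1 : ℤ)⟧) (h : ψ ≫ (oneSubShift X f)⟦(1 : ℤ)⟧' = 0) : ψ = 0 := by
  let e := shiftFunctorCompIsoId T (1 : ℤ) (-1) (add_neg_cancel 1)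
  have h₁ : (ψ⟦(-1 : ℤ)⟧' ≫ e.hom.app _) ≫ oneSubShift X f = 0 := by
    have := e.hom.naturality (oneSubShift X f)
    dsimp at this
    rw [Category.assoc, ← this, ← Category.assoc, ← Functor.map_comp, h, Functor.map_zero,
      zero_comp]
  have h₂ := eq_zero_of_comp_oneSubShift X f (hC.shift (-1)) _ h₁
  rw [Preadditive.IsIso.comp_right_eq_zero] at h₂
  exact (shiftFunctor T (-1 : ℤ)).map_injective (by rw [h₂, Functor.map_zero])

end Sequence

section Brown

variable {T : Type u} [Category.{v} T] [Preadditive T] [HasZeroObject T] [HasShift T ℤ]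
  [∀ n : ℤ, (shiftFunctor T n).Additive] [Pretriangulated T] [HasCoproducts.{v} T]

/-- A small category `C` together with a functor to `T` whose values are, up to isomorphism, all
the finitary objects, provided that these generate `T`. -/
structure IsCompactModel {C : Type v} [SmallCategory C] (i : C ⥤ T) : Prop where
  isFinitary : ∀ c, IsFinitary (i.obj c)
  exists_iso : ∀ X, IsFinitary X → ∃ c, Nonempty (i.obj c ≅ X)
  isZero : ∀ X : T, (∀ C, IsFinitary C → ∀ f : C ⟶ X, f = 0) → IsZero X

/-- Closure under coproducts and under cones. -/
structure IsClosedUnderCoproductsAndCones (P : ObjectProperty T) : Prop where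
  sigma : ∀ (J : Type v) (X : J → T), (∀ j, P (X j)) → P (∐ X)
  cone : ∀ {X Y Z : T} {f : X ⟶ Y} {g : Y ⟶ Z} {h : Z ⟶ X⟦(1 : ℤ)⟧},
    Triangle.mk f g h ∈ distTriang T → P X → P Y → P Z

/-- A contravariant functor to abelian groups which is exact on triangles and sends coproducts to
products. -/
structure IsBrownFunctor (F : Tᵒᵖ ⥤ AddCommGrpCat.{v}) : Prop where
  additive : F.Additive
  exact : ∀ {X Y Z : T} {f : X ⟶ Y} {g : Y ⟶ Z} {h : Z ⟶ X⟦(1 : ℤ)⟧},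
    Triangle.mk f g h ∈ distTriang T → ∀ y : F.obj (op Y), F.map f.op y = 0 →
    ∃ z : F.obj (op Z), F.map g.op z = y
  exists_lift : ∀ (J : Type v) (X : J → T) (x : ∀ j, F.obj (op (X j))),
    ∃ y : F.obj (op (∐ X)), ∀ j, F.map (Sigma.ι X j).op y = x j
  hom_ext : ∀ (J : Type v) (X : J → T) (y : F.obj (op (∐ X))),
    (∀ j, F.map (Sigma.ι X j).op y = 0) → y = 0

section Telescope

variable (X : ℕ → T) (f : ∀ n, X n ⟶ X (n + 1))

/-- The homotopy colimit of a sequence, with the properties needed for Brown representability. -/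
theorem exists_homotopyColimit :
    ∃ (Y : T) (g : ∀ n, X n ⟶ Y), (∀ n, f n ≫ g (n + 1) = g n) ∧
      (∀ P : ObjectProperty T, IsClosedUnderCoproductsAndCones P → (∀ n, P (X n)) → P Y) ∧
      (∀ C, IsFinitary C → ∀ φ : C ⟶ Y, ∃ n, ∃ φ' : C ⟶ X n, φ' ≫ g n = φ) ∧
      ∀ F : Tᵒᵖ ⥤ AddCommGrpCat.{v}, IsBrownFunctor F → ∀ x : ∀ n, F.obj (op (X n)),
        (∀ n, F.map (f n).op (x (n + 1)) = x n) → ∃ y, ∀ n, F.map (g n).op y = x n := by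
  obtain ⟨Y, g, d, hD⟩ := distinguished_cocone_triangle (oneSubShift X f)
  have hg (n : ℕ) : f n ≫ Sigma.ι (seqObj X) ⟨n + 1⟩ ≫ g = Sigma.ι (seqObj X) ⟨n⟩ ≫ g := by
    have := Sigma.ι (seqObj X) ⟨n⟩ ≫= distTriang_comp₁₂ hD
    rw [oneSubShift, colimit.ι_desc_assoc] at this
    dsimp at this
    rw [Preadditive.sub_comp, comp_zero, sub_eq_zero, Category.assoc] at this
    exact this.symm
  refine ⟨Y, fun n ↦ Sigma.ι (seqObj X) ⟨n⟩ ≫ g, hg, fun P hP h ↦ ?_, fun C hC φ ↦ ?_,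
    fun F hF x hx ↦ ?_⟩
  · exact hP.cone hD (hP.sigma _ _ fun n ↦ h n.down) (hP.sigma _ _ fun n ↦ h n.down)
  · have hφ : φ ≫ d = 0 := by
      refine eq_zero_of_comp_oneSubShift_shift X f hC _ ?_
      rw [Category.assoc, distTriang_comp₃₁ hD, comp_zero]
    obtain ⟨φ', rfl⟩ := distTriang_lift₃ hD φ hφ
    -- The finitely many components of `φ'` live at different stages; they are pushed to a common
    -- one and added there.
    have lift (n m : ℕ) (hnm : n ≤ m) (ψ : C ⟶ X n) : ∃ ψ' : C ⟶ X m,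
        ψ' ≫ Sigma.ι (seqObj X) ⟨m⟩ ≫ g = ψ ≫ Sigma.ι (seqObj X) ⟨n⟩ ≫ g := by
      induction m, hnm using Nat.le_induction with
      | base => exact ⟨ψ, rfl⟩
      | succ m _ ih =>
        obtain ⟨ψ', h⟩ := ih
        exact ⟨ψ' ≫ f _, by rw [Category.assoc, ← h]; exact congrArg (ψ' ≫ ·) (hg m)⟩
    obtain ⟨s, hs⟩ := hC _ _ φ'
    rw [eq_sum_of_comp_sigmaProj hs, Preadditive.sum_comp]
    clear hs hφ
    induction s using Finset.induction_on with
    | empty => exact ⟨0, 0, by simp⟩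
    | insert m s hm ih =>
      obtain ⟨n, ψ, hψ⟩ := ih
      obtain ⟨ψ₁, h₁⟩ := lift n (max n m.down) (le_max_left _ _) ψ
      obtain ⟨ψ₂, h₂⟩ := lift m.down (max n m.down) (le_max_right _ _) (φ' ≫ Sigma.π (seqObj X) m)
      refine ⟨max n m.down, ψ₁ + ψ₂, ?_⟩
      rw [Finset.sum_insert hm, ← hψ, Preadditive.add_comp, h₁, h₂, add_comm]
      simp
  · have := hF.additive
    obtain ⟨y, hy⟩ := hF.exists_lift _ (seqObj X) fun n ↦ x n.down
    have h0 : F.map (oneSubShift X f).op y = 0 := by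
      refine hF.hom_ext _ _ _ fun n ↦ ?_
      rw [← map_comp_op_apply, oneSubShift, colimit.ι_desc]
      dsimp only [Cofan.mk_ι_app]
      rw [map_sub_op_apply, map_comp_op_apply, hy, hy, hx, sub_self]
    obtain ⟨z, hz⟩ := hF.exact hD y h0
    refine ⟨z, fun n ↦ ?_⟩
    dsimp only
    rw [map_comp_op_apply, hz, hy]

end Telescope

variable {C : Type v} [SmallCategory C] {i : C ⥤ T}
  {F : Tᵒᵖ ⥤ AddCommGrpCat.{v}}

/-- One step of the cellular construction: `X'` is the cone of the sum of all maps `i c ⟶ X` that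
kill `x`, and exactness of `F` extends `x` over it. -/
lemma IsBrownFunctor.exists_kill (hF : IsBrownFunctor F) (i : C ⥤ T) {P : ObjectProperty T}
    (hP : IsClosedUnderCoproductsAndCones P) (hPi : ∀ c, P (i.obj c)) {X : T} (hX : P X)
    (x : F.obj (op X)) :
    ∃ (X' : T) (f : X ⟶ X') (x' : F.obj (op X')), P X' ∧ F.map f.op x' = x ∧
      ∀ (c : C) (φ : i.obj c ⟶ X), F.map φ.op x = 0 → φ ≫ f = 0 := by
  let J : Type v := Σ c : C, {φ : i.obj c ⟶ X // F.map φ.op x = 0}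
  let u : (∐ fun j : J ↦ i.obj j.1) ⟶ X := Sigma.desc fun j ↦ j.2.1
  obtain ⟨X', f, d, hD⟩ := distinguished_cocone_triangle u
  have hu : F.map u.op x = 0 := by
    refine hF.hom_ext _ _ _ fun j ↦ ?_
    rw [← map_comp_op_apply, colimit.ι_desc]
    exact j.2.2
  obtain ⟨x', hx'⟩ := hF.exact hD x hu
  refine ⟨X', f, x', hP.cone hD (hP.sigma _ _ fun j ↦ hPi _) hX, hx', fun c φ hφ ↦ ?_⟩
  have : φ = Sigma.ι (fun j : J ↦ i.obj j.1) ⟨c, φ, hφ⟩ ≫ u := by simp [u]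
  rw [this, Category.assoc, distTriang_comp₁₂ hD, comp_zero]

/-- `y` represents `F` on all finitary objects. -/
def IsUniversalOnFinitary (F : Tᵒᵖ ⥤ AddCommGrpCat.{v}) {Y : T} (y : F.obj (op Y)) : Prop :=
  ∀ C, IsFinitary C → Function.Bijective fun φ : C ⟶ Y ↦ F.map φ.op y

/-- The coproduct of all `i c`, indexed by elements of `F`, gives surjectivity. Iterating
`exists_kill` and passing to the telescope gives injectivity, since a finitary object maps through a
finite stage and its map dies at the next. The extra summands `X j` let prescribed elements be
absorbed; `P` records that only cones and coproducts are used. -/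
theorem IsBrownFunctor.exists_universalOnFinitary (hF : IsBrownFunctor F)
    (hi : IsCompactModel i) {P : ObjectProperty T} (hP : IsClosedUnderCoproductsAndCones P)
    (hPi : ∀ c, P (i.obj c)) {J : Type v} (X : J → T) (hX : ∀ j, P (X j))
    (x : ∀ j, F.obj (op (X j))) :
    ∃ (Y : T) (y : F.obj (op Y)) (a : ∀ j, X j ⟶ Y), P Y ∧ (∀ j, F.map (a j).op y = x j) ∧
      IsUniversalOnFinitary F y := by
  have := hF.additive
  let J' : Type v := J ⊕ Σ c : C, F.obj (op (i.obj c))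
  let X' : J' → T := Sum.elim X fun p ↦ i.obj p.1
  obtain ⟨x₀, hx₀⟩ := hF.exists_lift J' X' (fun j ↦ match j with
    | .inl j => x j
    | .inr p => p.2)
  let S := {p : Σ Z : T, F.obj (op Z) // P p.1}
  let s₀ : S := ⟨⟨∐ X', x₀⟩, hP.sigma _ _ (by rintro (j | p); exacts [hX j, hPi _])⟩
  choose nextObj nextMap nextElt h₁ h₂ h₃ using
    fun s : S ↦ hF.exists_kill i hP hPi s.2 s.1.2
  let seq : ℕ → S := fun n ↦ Nat.rec s₀ (fun _ s ↦ ⟨⟨nextObj s, nextElt s⟩, h₁ s⟩) n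
  obtain ⟨Y, g, hg, hPY, hfac, hlift⟩ := exists_homotopyColimit (fun n ↦ (seq n).1.1)
    (fun n ↦ nextMap (seq n))
  obtain ⟨y, hy⟩ := hlift F hF (fun n ↦ (seq n).1.2) (fun n ↦ h₂ (seq n))
  have hy₀ (j : J') : F.map (Sigma.ι X' j ≫ g 0).op y = F.map (Sigma.ι X' j).op x₀ := by
    rw [map_comp_op_apply]
    exact congrArg _ (hy 0)
  have inj (c : C) (φ : i.obj c ⟶ Y) (hφ : F.map φ.op y = 0) : φ = 0 := by
    obtain ⟨n, φ', rfl⟩ := hfac _ (hi.isFinitary c) φ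
    rw [map_comp_op_apply, hy] at hφ
    rw [← hg, ← Category.assoc]
    exact (congrArg (· ≫ g (n + 1)) (h₃ (seq n) c φ' hφ)).trans zero_comp
  refine ⟨Y, y, fun j ↦ Sigma.ι X' (.inl j) ≫ g 0, hPY P hP fun n ↦ (seq n).2,
    fun j ↦ (hy₀ _).trans (hx₀ (.inl j)), fun D hD ↦ ?_⟩
  obtain ⟨c, ⟨e⟩⟩ := hi.exists_iso D hD
  constructor
  · intro φ ψ h
    rw [← sub_eq_zero, ← cancel_epi e.hom, comp_zero]
    refine inj c _ ?_
    rw [map_comp_op_apply, map_sub_op_apply]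
    have h' : F.map φ.op y = F.map ψ.op y := h
    rw [h', sub_self, map_zero]
  · intro z
    refine ⟨e.inv ≫ Sigma.ι X' (.inr ⟨c, F.map e.hom.op z⟩) ≫ g 0, ?_⟩
    dsimp only
    rw [map_comp_op_apply]
    refine (congrArg _ ((hy₀ _).trans (hx₀ (.inr _)))).trans ?_
    dsimp only
    rw [← map_comp_op_apply, e.inv_hom_id, map_id_op_apply]

lemma IsCompactModel.isIso_of_bijective (hi : IsCompactModel i) {X Y : T} (h : X ⟶ Y)
    (hh : ∀ C, IsFinitary C → Function.Bijective fun φ : C ⟶ X ↦ φ ≫ h) : IsIso h := by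
  obtain ⟨Z, v, w, hD⟩ := distinguished_cocone_triangle h
  refine (Triangle.isZero₃_iff_isIso₁ _ hD).1 (hi.isZero _ fun C hC (φ : C ⟶ Z) ↦ ?_)
  have hw : φ ≫ w = 0 := by
    let e := shiftFunctorCompIsoId T (1 : ℤ) (-1) (add_neg_cancel 1)
    have h₀ : φ ≫ w ≫ h⟦(1 : ℤ)⟧' = 0 := by rw [distTriang_comp₃₁ hD, comp_zero]
    have h₁ : ((φ ≫ w)⟦(-1 : ℤ)⟧' ≫ e.hom.app X) ≫ h = 0 := by
      have := e.hom.naturality h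
      dsimp at this
      rw [Category.assoc, ← this, ← Category.assoc, ← Functor.map_comp, Category.assoc, h₀,
        Functor.map_zero, zero_comp]
    have h₂ := (hh _ (hC.shift (-1))).1 (h₁.trans zero_comp.symm)
    rw [Preadditive.IsIso.comp_right_eq_zero] at h₂
    exact (shiftFunctor T (-1 : ℤ)).map_injective (by rw [h₂, Functor.map_zero])
  obtain ⟨ψ, rfl⟩ := distTriang_lift₃ hD φ hw
  obtain ⟨χ, rfl⟩ := (hh C hC).2 ψ
  have : (χ ≫ h) ≫ v = 0 := by rw [Category.assoc, distTriang_comp₁₂ hD, comp_zero]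
  exact this

lemma IsCompactModel.isIso_of_universal (hi : IsCompactModel i) {X Y : T} {x : F.obj (op X)}
    {y : F.obj (op Y)} (hx : IsUniversalOnFinitary F x) (hy : IsUniversalOnFinitary F y)
    (h : X ⟶ Y) (hh : F.map h.op y = x) : IsIso h := by
  refine hi.isIso_of_bijective h fun C hC ↦ ?_
  have : (fun φ : C ⟶ X ↦ F.map φ.op x) = (fun φ : C ⟶ Y ↦ F.map φ.op y) ∘ fun φ ↦ φ ≫ h := by
    ext φ
    dsimp only [Function.comp_apply]
    rw [map_comp_op_apply, hh]
  have hx' := hx C hC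
  rw [this] at hx'
  exact (Function.Bijective.of_comp_iff' (hy C hC) _).1 hx'

/-- Brown representability. -/
theorem IsBrownFunctor.exists_representation (hF : IsBrownFunctor F) (hi : IsCompactModel i) :
    ∃ (Y : T) (y : F.obj (op Y)), ∀ Z : T, Function.Bijective fun φ : Z ⟶ Y ↦ F.map φ.op y := by
  have := hF.additive
  have hP : IsClosedUnderCoproductsAndCones (⊤ : ObjectProperty T) :=
    ⟨fun _ _ _ ↦ trivial, fun _ _ _ ↦ trivial⟩
  obtain ⟨Y, y, -, -, -, hy⟩ := hF.exists_universalOnFinitary hi hP (fun _ ↦ trivial)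
    (J := PEmpty) PEmpty.elim (fun j ↦ j.elim) (fun j ↦ j.elim)
  refine ⟨Y, y, fun Z ↦ ⟨fun φ ψ h ↦ ?_, fun z ↦ ?_⟩⟩
  -- Since `y` extends over the cone of `φ - ψ`, absorbing that cone into a universal object makes
  -- `v` split mono, whence `φ - ψ = 0`.
  · obtain ⟨Z', v, w, hD⟩ := distinguished_cocone_triangle (φ - ψ)
    obtain ⟨z', hz'⟩ := hF.exact hD y (by
      have h' : F.map φ.op y = F.map ψ.op y := h
      rw [map_sub_op_apply, h', sub_self])
    obtain ⟨Y', y', a, -, ha, hy'⟩ := hF.exists_universalOnFinitary hi hP (fun _ ↦ trivial)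
      (J := PUnit) (fun _ ↦ Z') (fun _ ↦ trivial) (fun _ ↦ z')
    have : IsIso (v ≫ a ⟨⟩) := hi.isIso_of_universal hy hy' _ (by
      rw [map_comp_op_apply, ha, hz'])
    have h0 : (φ - ψ) ≫ v = 0 := distTriang_comp₁₂ hD
    rw [← sub_eq_zero, ← cancel_mono (v ≫ a ⟨⟩), ← Category.assoc, h0, zero_comp, zero_comp]
  -- Absorbing both `(Y, y)` and `(Z, z)` leaves `Y` unchanged up to isomorphism, so `z` is already
  -- pulled back from `y`.
  · obtain ⟨Y', y', a, -, ha, hy'⟩ := hF.exists_universalOnFinitary hi hP (fun _ ↦ trivial)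
      (J := Option PUnit) (fun j ↦ j.elim Y fun _ ↦ Z) (fun _ ↦ trivial)
      (fun j ↦ match j with
        | none => y
        | some _ => z)
    let b : Y ⟶ Y' := a none
    have hb : F.map b.op y' = y := ha none
    have : IsIso b := hi.isIso_of_universal hy hy' b hb
    let a' : Z ⟶ Y' := a (some ⟨⟩)
    refine ⟨a' ≫ inv b, ?_⟩
    have h₁ : F.map (inv b).op y = y' := by
      rw [← hb, ← map_comp_op_apply, IsIso.inv_hom_id, map_id_op_apply]
    dsimp only
    rw [map_comp_op_apply, h₁]
    exact ha (some ⟨⟩)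

lemma isBrownFunctor_preadditiveYoneda (Z : T) : IsBrownFunctor (preadditiveYoneda.obj Z) where
  additive := inferInstance
  exact hD y hy := by
    obtain ⟨z, hz⟩ := distTriang_desc₂ hD y hy
    exact ⟨z, hz.symm⟩
  exists_lift J X x := ⟨Sigma.desc x, fun j ↦ colimit.ι_desc _ _⟩
  hom_ext J X (y : ∐ X ⟶ Z) h := Sigma.hom_ext _ _ fun j ↦ (h j).trans comp_zero.symm

/-- A compactly generated triangulated category is generated by its compact objects under cones
and coproducts. -/
theorem IsCompactModel.prop_of_closed (hi : IsCompactModel i) {P : ObjectProperty T}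
    [P.IsClosedUnderIsomorphisms] (hP : IsClosedUnderCoproductsAndCones P)
    (hPi : ∀ c, P (i.obj c)) (Z : T) : P Z := by
  -- For `F = Hom(-, Z)` the universal element is a map `Y ⟶ Z` bijective on maps from compact
  -- objects, hence an isomorphism from a cellular object.
  obtain ⟨Y, y, -, hY, -, hy⟩ := (isBrownFunctor_preadditiveYoneda Z).exists_universalOnFinitary
    hi hP hPi (J := PEmpty) PEmpty.elim (fun j ↦ j.elim) (fun j ↦ j.elim)
  have : IsIso (show Y ⟶ Z from y) := hi.isIso_of_bijective _ hy
  exact P.prop_of_iso (asIso (show Y ⟶ Z from y)) hY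

end Brown

/-! ### Topologies on the compact model and the sheaf-valued functor -/

section Topology

variable {C : Type*} [Category* C] {B : Type*} [Category* B] [HasZeroMorphisms B]

/-- The topology of those sieves `S` such that the images under `K` of all the pullbacks of `S`
jointly detect whether a morphism to an object in `P` is zero. -/
def denseTopology (K : C ⥤ B) (P : ObjectProperty B) : GrothendieckTopology C where
  sieves c := {S | ∀ ⦃d : C⦄ (f : d ⟶ c) ⦃Z : B⦄, P Z → ∀ q : K.obj d ⟶ Z,
    (∀ ⦃e : C⦄ (g : e ⟶ d), S (g ≫ f) → K.map g ≫ q = 0) → q = 0}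
  top_mem' c d f Z _ q h := by simpa using h (𝟙 d) trivial
  pullback_stable' c c' S k hS d f Z hZ q h :=
    hS (f ≫ k) hZ q fun e g hg ↦ h g (by simpa using hg)
  transitive' c S hS R hR d f Z hZ q h := by
    refine hS f hZ q fun e g hg ↦ ?_
    refine hR hg (𝟙 e) hZ _ fun e' l hl ↦ ?_
    rw [← Category.assoc, ← K.map_comp]
    exact h _ (by simpa using hl)

end Topology

lemma exact_of_exact_evaluation {K A : Type*} [Category* K] [Category* A] [Abelian A]
    (S : ShortComplex (K ⥤ A)) (h : ∀ k, (S.map ((evaluation K A).obj k)).Exact) : S.Exact := by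
  rw [ShortComplex.exact_iff_isZero_homology, Functor.isZero_iff]
  intro k
  exact ((ShortComplex.exact_iff_isZero_homology _).1 (h k)).of_iso
    (S.mapHomologyIso ((evaluation K A).obj k)).symm

section RestrictedYoneda

variable {T : Type u} [Category.{v} T] [Preadditive T] {C : Type v} [SmallCategory C]
  (i : C ⥤ T)

/-- The functor sending `X` to the presheaf `Hom(i -, X)`. -/
def homPresheaf : T ⥤ Cᵒᵖ ⥤ AddCommGrpCat.{v} :=
  preadditiveYoneda ⋙ (Functor.whiskeringLeft _ _ _).obj i.op

/-- The sieve of those `k` such that the composition of `i k` and `φ` is zero. -/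
def annihilator {c : C} {X : T} (φ : i.obj c ⟶ X) : Sieve c where
  arrows _ k := i.map k ≫ φ = 0
  downward_closed {_ _} k hk l := by
    rw [i.map_comp, Category.assoc, hk, comp_zero]

variable (J : GrothendieckTopology C)

/-- The functor sending `X` to the sheaf associated with `Hom(i -, X)`. -/
def homSheaf : T ⥤ Sheaf J AddCommGrpCat.{v} :=
  homPresheaf i ⋙ presheafToSheaf J AddCommGrpCat.{v}

instance : (homPresheaf i).PreservesZeroMorphisms where
  map_zero X Y := by
    ext c (φ : i.obj c.unop ⟶ X)
    exact comp_zero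

instance : (homSheaf i J).PreservesZeroMorphisms :=
  inferInstanceAs (homPresheaf i ⋙ presheafToSheaf J _).PreservesZeroMorphisms

/-- The sheafification of `P` vanishes when the zero endomorphism of `P` is locally injective; the
annihilator of `φ` is the equalizer sieve of `φ` and `0`. -/
lemma isZero_homSheaf_obj_iff (X : T) :
    IsZero ((homSheaf i J).obj X) ↔
      ∀ (c : C) (φ : i.obj c ⟶ X), annihilator i φ ∈ J c := by
  let P := (homPresheaf i).obj X
  have h₁ : IsZero ((homSheaf i J).obj X) ↔ Sheaf.IsLocallyInjective
      ((presheafToSheaf J AddCommGrpCat.{v}).map (0 : P ⟶ P)) := by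
    rw [Functor.map_zero]
    change IsZero ((presheafToSheaf J AddCommGrpCat.{v}).obj P) ↔ _
    generalize (presheafToSheaf J AddCommGrpCat.{v}).obj P = Q
    constructor
    · intro h
      have : IsIso (0 : Q ⟶ Q) := ⟨0, h.eq_of_src _ _, h.eq_of_src _ _⟩
      infer_instance
    · intro h
      have : Mono (0 : Q ⟶ Q) := Sheaf.mono_of_isLocallyInjective _
      exact (IsZero.iff_id_eq_zero _).2 (by rw [← cancel_mono (0 : Q ⟶ Q), comp_zero, comp_zero])
  rw [h₁, Presheaf.isLocallyInjective_presheafToSheaf_map_iff]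
  constructor
  · intro h c φ
    have := Presheaf.equalizerSieve_mem J (0 : P ⟶ P) (X := op c) φ 0 rfl
    convert this using 1
    ext d k
    change i.map k ≫ φ = 0 ↔ i.map k ≫ φ = i.map k ≫ 0
    rw [comp_zero]
  · intro h
    refine ⟨fun {c} (x : i.obj c.unop ⟶ X) (y : i.obj c.unop ⟶ X) _ ↦ ?_⟩
    convert h c.unop (x - y) using 1
    ext d k
    change i.map k ≫ x = i.map k ≫ y ↔ i.map k ≫ (x - y) = 0
    rw [Preadditive.comp_sub, sub_eq_zero]

lemma mono_homSheaf_map {X Y : T} (f : X ⟶ Y)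
    (hf : ∀ (c : C) (φ : i.obj c ⟶ X), φ ≫ f = 0 → φ = 0) : Mono ((homSheaf i J).map f) := by
  have : ∀ c, Mono (((homPresheaf i).map f).app c) := fun c ↦ by
    refine ConcreteCategory.mono_of_injective _ ?_
    refine (injective_iff_map_eq_zero (((homPresheaf i).map f).app c).hom).2 ?_
    exact fun φ hφ ↦ hf _ φ hφ
  have : Mono ((homPresheaf i).map f) := NatTrans.mono_of_mono_app _
  exact inferInstanceAs (Mono ((presheafToSheaf J _).map ((homPresheaf i).map f)))

lemma preservesCoproducts_homSheaf (hi : ∀ c, compactObjects T (i.obj c)) (I : Type v) :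
    PreservesColimitsOfShape (Discrete I) (homSheaf i J) := by
  have : PreservesColimitsOfShape (Discrete I) (homPresheaf i) :=
    preservesColimitsOfShape_of_evaluation _ _ fun c ↦ hi c.unop I
  exact inferInstanceAs
    (PreservesColimitsOfShape (Discrete I) (homPresheaf i ⋙ presheafToSheaf J _))

instance [HasZeroObject T] [HasShift T ℤ] [∀ n : ℤ, (shiftFunctor T n).Additive]
    [Pretriangulated T] : (homPresheaf i).IsHomological where
  exact D hD := exact_of_exact_evaluation _ fun c ↦
    (preadditiveCoyoneda.obj (op (i.obj c.unop))).map_distinguished_exact D hD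

instance [HasZeroObject T] [HasShift T ℤ] [∀ n : ℤ, (shiftFunctor T n).Additive]
    [Pretriangulated T] : (homSheaf i J).IsHomological where
  exact D hD := ((homPresheaf i).map_distinguished_exact D hD).map (presheafToSheaf J _)

end RestrictedYoneda

/-! ### Adjusting the universe of the target category -/

section UniverseLift

attribute [local instance] uliftCategory

/-- The preadditive structure on a universe lift. -/
abbrev preadditiveULift (A : Type u) [Category.{v} A] [Preadditive A] :
    Preadditive (ULift.{w} A) :=
  .ofFullyFaithful (ULift.equivalence (C := A)).fullyFaithfulInverse

lemma exists_equivalence_ulift (A : Type u) [Category.{v} A] [Abelian A]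
    [HasColimitsOfSize.{v, v} A] [AB5 A] :
    ∃ (B : Type max w u) (_ : Category.{v} B) (_ : Abelian B) (_ : HasColimitsOfSize.{v, v} B)
      (_ : AB5 B) (e : A ≌ B), e.functor.Additive := by
  let := preadditiveULift.{w} A
  let e : A ≌ ULift.{w} A := ULift.equivalence
  have h₁ : e.inverse.Additive := e.symm.fullyFaithfulFunctor.additive_ofFullyFaithful
  have h₂ : e.functor.Additive := e.symm.additive_inverse_of_FullyFaithful
  have : HasFiniteProducts (ULift.{w} A) :=
    ⟨fun _ ↦ Adjunction.hasLimitsOfShape_of_equivalence e.inverse⟩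
  let : Abelian (ULift.{w} A) := abelianOfEquivalence e.inverse
  have : HasColimitsOfSize.{v, v} (ULift.{w} A) :=
    Adjunction.has_colimits_of_equivalence e.inverse
  exact ⟨ULift.{w} A, inferInstance, inferInstance, inferInstance,
    ⟨fun J _ _ ↦ HasExactColimitsOfShape.of_codomain_equivalence J e⟩, e, h₂⟩

lemma exists_equivalence_ulift_sheaf {C : Type v} [SmallCategory C]
    (J : GrothendieckTopology C) :
    ∃ (B : Type max w (v + 1)) (_ : Category.{v} B) (_ : Abelian B)
      (_ : HasColimitsOfSize.{v, v} B) (_ : AB5 B) (e : Sheaf J AddCommGrpCat.{v} ≌ B),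
      e.functor.Additive := by
  have : HasColimitsOfSize.{v, v} (Sheaf J AddCommGrpCat.{v}) := ⟨fun _ _ ↦ inferInstance⟩
  exact exists_equivalence_ulift.{w} (Sheaf J AddCommGrpCat.{v})

end UniverseLift

/-! ### Pure-injectives and the step from (2) to (1) -/

section PureMono

variable {T : Type u} [Category.{v} T] [Preadditive T] [HasCoproducts.{v} T]

lemma isPureMono_iff {X Y : T} (f : X ⟶ Y) :
    IsPureMono f ↔ ∀ C, IsFinitary C → ∀ φ : C ⟶ X, φ ≫ f = 0 → φ = 0 := by
  constructor
  · intro (h : Mono ((restrictedYoneda T).map f)) C hC φ hφ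
    have : (restrictedYoneda T).map φ = (restrictedYoneda T).map 0 := by
      rw [← cancel_mono ((restrictedYoneda T).map f), ← Functor.map_comp, ← Functor.map_comp, hφ,
        zero_comp]
    let c : Compacts T := ⟨C, compactObjects_of_isFinitary hC⟩
    have h' : 𝟙 C ≫ φ = 𝟙 C ≫ 0 :=
      ConcreteCategory.congr_hom (congr_app (congrArg (fun α ↦ α.hom) this) (op c)) (𝟙 C)
    simpa using h'
  · intro h
    have : ∀ c, Mono (((restrictedYoneda T).map f).hom.app c) := fun c ↦ by
      refine ConcreteCategory.mono_of_injective _ ?_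
      refine (injective_iff_map_eq_zero (((restrictedYoneda T).map f).hom.app c).hom).2 ?_
      exact fun φ hφ ↦ h _ (isFinitary_of_compactObjects c.unop.property) φ hφ
    have : Mono ((ObjectProperty.ι _).map ((restrictedYoneda T).map f)) :=
      NatTrans.mono_of_mono_app ((restrictedYoneda T).map f).hom
    exact (ObjectProperty.ι _).mono_of_mono_map this

lemma IsCompactlyGenerated.exists_isCompactModel (hT : IsCompactlyGenerated T) :
    ∃ (C : Type v) (_ : SmallCategory C) (i : C ⥤ T), i.Full ∧ IsCompactModel i := by
  have := hT.essentiallySmall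
  let e := equivSmallModel.{v} (compactObjects T).FullSubcategory
  refine ⟨SmallModel.{v} (compactObjects T).FullSubcategory, inferInstance,
    e.inverse ⋙ (compactObjects T).ι, inferInstance,
    fun c ↦ isFinitary_of_compactObjects (e.inverse.obj c).property, fun X hX ↦ ?_, fun X h ↦ ?_⟩
  · let X' : (compactObjects T).FullSubcategory := ⟨X, compactObjects_of_isFinitary hX⟩
    exact ⟨e.functor.obj X', ⟨(compactObjects T).ι.mapIso (e.unitIso.app X').symm⟩⟩
  · exact hT.isZero_of_forall_eq_zero X fun C hC ↦ h C (isFinitary_of_compactObjects hC)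

end PureMono

section

variable {T : Type u} [Category.{v} T] [Preadditive T] [HasZeroObject T] [HasShift T ℤ]
  [∀ n : ℤ, (shiftFunctor T n).Additive] [Pretriangulated T] [HasCoproducts.{v} T]

/-- A morphism to a pure-injective object extends along any morphism whose annihilator is
contained in its own. -/
lemma IsPureInjective.exists_extension {Y : T} (hY : IsPureInjective Y) {D X : T} (φ : D ⟶ X)
    (g : D ⟶ Y) (h : ∀ C, IsFinitary C → ∀ k : C ⟶ D, k ≫ φ = 0 → k ≫ g = 0) :
    ∃ g' : X ⟶ Y, φ ≫ g' = g := by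
  -- The cone of `D ⟶ X ⊞ Y` is a weak pushout. The hypothesis on annihilators makes `Y ⟶ Z` a
  -- pure-monomorphism, and a retraction of it yields the extension up to sign.
  obtain ⟨Z, b, d, hD⟩ := distinguished_cocone_triangle (biprod.lift φ g)
  have hp : IsPureMono (biprod.inr ≫ b) := by
    refine (isPureMono_iff _).2 fun C hC y hy ↦ ?_
    obtain ⟨k, hk⟩ := distTriang_lift₂ hD (y ≫ biprod.inr) (by rw [Category.assoc, hy])
    have h₁ : k ≫ φ = 0 := by simpa using (hk =≫ biprod.fst).symm
    have h₂ : y = k ≫ g := by simpa using hk =≫ biprod.snd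
    rw [h₂, h C hC k h₁]
  obtain ⟨⟨r, hr⟩⟩ := hY _ hp
  refine ⟨-(biprod.inl ≫ b ≫ r), ?_⟩
  have h0 : biprod.lift φ g ≫ b ≫ r = 0 := by
    rw [← Category.assoc, distTriang_comp₁₂ hD, zero_comp]
  rw [biprod.lift_eq, Preadditive.add_comp, Category.assoc, Category.assoc] at h0
  rw [Category.assoc] at hr
  rw [hr, Category.comp_id] at h0
  rw [Preadditive.comp_neg, eq_comm, eq_neg_iff_add_eq_zero, add_comm, h0]

/-- The map following `g` in its triangle is a pure-monomorphism because `g` is phantom; it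
therefore splits, and its composite with `g` is zero. -/
lemma IsPureInjective.eq_zero_of_phantom {Y : T} (hY : IsPureInjective Y) {X : T} (g : X ⟶ Y)
    (h : ∀ C, IsFinitary C → ∀ φ : C ⟶ X, φ ≫ g = 0) : g = 0 := by
  obtain ⟨Z, f, d, hD⟩ := distinguished_cocone_triangle g
  have hp : IsPureMono f := by
    refine (isPureMono_iff _).2 fun C hC y hy ↦ ?_
    obtain ⟨k, rfl⟩ := distTriang_lift₂ hD y hy
    exact h C hC k
  have := hY _ hp
  rw [← cancel_mono f, distTriang_comp₁₂ hD, zero_comp]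

lemma isZero_homSheaf_obj_iff_of_isPureInjective {C : Type v} [SmallCategory C] {i : C ⥤ T}
    [i.Full] (hi : IsCompactModel i) {I : Type t} (Y : I → T) (hY : ∀ k, IsPureInjective (Y k))
    (X : T) :
    IsZero ((homSheaf i (denseTopology i fun Z ↦ ∃ k, Y k = Z)).obj X) ↔
      ∀ (k : I) (f : X ⟶ Y k), f = 0 := by
  rw [isZero_homSheaf_obj_iff]
  constructor
  · intro h k f
    refine (hY k).eq_zero_of_phantom f fun D hD φ ↦ ?_
    obtain ⟨c, ⟨e⟩⟩ := hi.exists_iso D hD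
    rw [← cancel_epi e.hom, comp_zero, ← Category.assoc]
    refine h c (e.hom ≫ φ) (𝟙 c) ⟨k, rfl⟩ _ fun d g hg ↦ ?_
    have hg' : i.map g ≫ e.hom ≫ φ = 0 := by simpa using! hg
    rw [← Category.assoc, hg', zero_comp]
  · rintro h c φ d f _ ⟨k, rfl⟩ q hq
    obtain ⟨q', rfl⟩ := (hY k).exists_extension (i.map f ≫ φ) q fun D hD l hl ↦ by
      obtain ⟨e, ⟨α⟩⟩ := hi.exists_iso D hD
      obtain ⟨g, hg⟩ := i.map_surjective (α.hom ≫ l)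
      rw [← cancel_epi α.hom, comp_zero, ← Category.assoc, ← hg]
      refine hq g ?_
      change i.map (g ≫ f) ≫ φ = 0
      rw [i.map_comp, hg, Category.assoc, Category.assoc, hl, comp_zero]
    rw [h k q', comp_zero]

lemma isCohomological_of_isPureInjective (hT : IsCompactlyGenerated T) (L : ObjectProperty T)
    {I : Type t} (Y : I → T) (hs : IsSuspensionStable Y) (hY : ∀ k, IsPureInjective (Y k))
    (hL : ∀ X, L X ↔ ∀ (k : I) (f : X ⟶ Y k), f = 0) : IsCohomological.{w} L := by
  obtain ⟨C, _, i, _, hi⟩ := hT.exists_isCompactModel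
  let G := homSheaf i (denseTopology i fun Z ↦ ∃ k, Y k = Z)
  obtain ⟨B, _, _, _, _, e, _⟩ := exists_equivalence_ulift_sheaf.{w}
    (denseTopology i fun Z ↦ ∃ k, Y k = Z)
  refine ⟨B, inferInstance, inferInstance, inferInstance, inferInstance, G ⋙ e.functor,
    ⟨fun D hD ↦ (G.map_distinguished_exact D hD).map e.functor⟩, fun J ↦ ?_, fun X ↦ ?_⟩
  · have : PreservesColimitsOfShape (Discrete J) G :=
      preservesCoproducts_homSheaf i _ (fun c ↦ compactObjects_of_isFinitary (hi.isFinitary c)) J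
    infer_instance
  · have (n : ℤ) : IsZero ((G ⋙ e.functor).obj (X⟦n⟧)) ↔
        ∀ (k : I) (f : X⟦n⟧ ⟶ Y k), f = 0 := by
      rw [← isZero_homSheaf_obj_iff_of_isPureInjective hi Y hY]
      exact ⟨fun h ↦ (e.inverse.map_isZero h).of_iso (e.unitIso.app _),
        fun h ↦ e.functor.map_isZero h⟩
    simp only [this]
    rw [hL]
    constructor
    · intro h n k f
      -- Suspension stability moves the shift from `X` to the target.
      obtain ⟨j, ⟨α⟩⟩ := hs k (-n)
      let ε := shiftFunctorCompIsoId T n (-n) (add_neg_cancel n)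
      have h0 := h j (ε.inv.app X ≫ f⟦-n⟧' ≫ α.inv)
      refine (shiftFunctor T (-n)).map_injective ?_
      rwa [Functor.map_zero, ← cancel_epi (ε.inv.app X), comp_zero, ← cancel_mono α.inv,
        zero_comp, Category.assoc]
    · intro h k f
      let ε := (shiftFunctorZero T ℤ).app X
      rw [← cancel_epi ε.hom, comp_zero]
      exact h 0 k _

end

/-! ### Local arguments in an (AB5) category -/

section LocalTopology

variable {A : Type*} [Category.{v} A] [Abelian A]

variable (A) in
/-- The topology on an abelian category given by the universally jointly epimorphic sieves. -/
def localTopology : GrothendieckTopology A := denseTopology (𝟭 A) ⊤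

lemma mem_localTopology_iff {W : A} (S : Sieve W) :
    S ∈ localTopology A W ↔ ∀ ⦃V : A⦄ (f : V ⟶ W) ⦃Z : A⦄ (q : V ⟶ Z),
      (∀ ⦃U : A⦄ (g : U ⟶ V), S (g ≫ f) → g ≫ q = 0) → q = 0 :=
  ⟨fun h _ f _ q hq ↦ h f trivial q hq, fun h _ f _ _ q hq ↦ h f q hq⟩

lemma eq_zero_of_mem_localTopology {W Z : A} {S : Sieve W} (hS : S ∈ localTopology A W)
    (q : W ⟶ Z) (hq : ∀ ⦃U : A⦄ (g : U ⟶ W), S g → g ≫ q = 0) : q = 0 :=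
  (mem_localTopology_iff S).1 hS (𝟙 W) q fun U g hg ↦ hq g (by simpa using hg)

lemma mem_localTopology_of_epi {W W' : A} (π : W' ⟶ W) [Epi π] {S : Sieve W} (hS : S π) :
    S ∈ localTopology A W := by
  rw [mem_localTopology_iff]
  intro V f Z q hq
  rw [← cancel_epi (pullback.fst f π), comp_zero]
  exact hq _ (by rw [pullback.condition]; exact S.downward_closed hS _)

lemma mem_localTopology_of_pullback_epi {W W' : A} (π : W' ⟶ W) [Epi π] {R : Sieve W}
    (hR : R.pullback π ∈ localTopology A W') : R ∈ localTopology A W := by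
  refine (localTopology A).transitive (mem_localTopology_of_epi π
    (S := Sieve.generate (Presieve.singleton π))
    ⟨_, 𝟙 _, π, Presieve.singleton_self π, Category.id_comp _⟩) R ?_
  rintro V _ ⟨_, g, _, ⟨⟩, rfl⟩
  rw [Sieve.pullback_comp]
  exact (localTopology A).pullback_stable g hR

attribute [local instance] IsFiltered.isConnected in
-- Exact filtered colimits commute with pullbacks, so base change along `z` preserves the colimit.
lemma isIso_colimit_desc_pullback {J : Type*} [Category* J] [IsFiltered J]
    [HasColimitsOfShape J A] [HasExactColimitsOfShape J A] {Y : J ⥤ A} {c : Cocone Y}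
    (hc : IsColimit c) {X : A} (z : X ⟶ c.pt) :
    IsIso (colimit.desc (pullback c.ι ((Functor.const J).map z))
      (Cocone.mk X { app j := (pullback.snd c.ι ((Functor.const J).map z)).app j })) := by
  let d (W : A) : colimit ((Functor.const J).obj W) ⟶ W := colimit.desc _ (constCocone J W)
  have hd (W : A) : IsIso (d W) :=
    ((colimit.isColimit _).coconePointUniqueUpToIso (isColimitConstCocone J W)).isIso_hom
  have ι_d (W : A) (j : J) : colimit.ι ((Functor.const J).obj W) j ≫ d W = 𝟙 W :=
    colimit.ι_desc _ _
  have h₁ : IsIso (colimMap c.ι) := by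
    have : colimMap c.ι ≫ d c.pt = colimit.desc Y c := by
      refine colimit.hom_ext fun j ↦ ?_
      rw [ι_colimMap_assoc, colimit.ι_desc]
      exact (congrArg (c.ι.app j ≫ ·) (ι_d _ j)).trans (Category.comp_id _)
    have h : IsIso (colimMap c.ι ≫ d c.pt) := by
      rw [this]
      exact ((colimit.isColimit _).coconePointUniqueUpToIso hc).isIso_hom
    exact IsIso.of_isIso_comp_right _ (d c.pt)
  have h₂ : IsIso (colimMap (pullback.snd c.ι ((Functor.const J).map z))) :=
    MorphismProperty.of_isPullback (P := MorphismProperty.isomorphisms A)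
      ((IsPullback.of_hasPullback c.ι ((Functor.const J).map z)).map colim) h₁
  have h₃ : colimMap (pullback.snd c.ι ((Functor.const J).map z)) ≫ d X =
      colimit.desc (pullback c.ι ((Functor.const J).map z))
        (Cocone.mk X { app j := (pullback.snd c.ι ((Functor.const J).map z)).app j }) := by
    refine colimit.hom_ext fun j ↦ ?_
    rw [ι_colimMap_assoc, colimit.ι_desc]
    exact (congrArg ((pullback.snd c.ι ((Functor.const J).map z)).app j ≫ ·) (ι_d _ j)).trans
      (Category.comp_id _)
  rw [← h₃]
  infer_instance

open CoproductsFromFiniteFiltered in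
-- A coproduct is the filtered colimit of its finite subcoproducts. Pulling these back along `f ≫ w`
-- exhibits `V` as a filtered colimit of objects on which the sieve holds.
lemma finite_mem_localTopology [HasColimitsOfSize.{v, v} A] [AB5 A] {J : Type v} (M : J → A)
    {W : A} (w : W ⟶ ∐ M) (S : Sieve W)
    (hS : ∀ ⦃V : A⦄ (g : V ⟶ W) (s : Finset J), (g ≫ w) ≫ sigmaProj M s = g ≫ w → S g) :
    S ∈ localTopology A W := by
  rw [mem_localTopology_iff]
  intro V f Z q hq
  let c := finiteSubcoproductsCocone M
  have hc : IsColimit c := isColimitFiniteSubproductsCocone M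
  have := isIso_colimit_desc_pullback hc (f ≫ w)
  rw [← cancel_epi (colimit.desc (pullback c.ι ((Functor.const _).map (f ≫ w)))
      (Cocone.mk V { app j := (pullback.snd c.ι ((Functor.const _).map (f ≫ w))).app j }))]
  refine colimit.hom_ext fun s ↦ ?_
  rw [colimit.ι_desc_assoc, comp_zero, comp_zero]
  refine hq _ (hS _ (s.image Discrete.as) ?_)
  let a : (∐ fun x : s ↦ (Discrete.functor M).obj x) ⟶ ∐ M := c.ι.app s
  let p : _ ⟶ ∐ fun x : s ↦ (Discrete.functor M).obj x :=
    (pullback.fst c.ι ((Functor.const _).map (f ≫ w))).app s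
  let r : _ ⟶ V := (pullback.snd c.ι ((Functor.const _).map (f ≫ w))).app s
  have h₁ : p ≫ a = r ≫ f ≫ w :=
    congr_app (pullback.condition (f := c.ι) (g := (Functor.const _).map (f ≫ w))) s
  have h₂ : a ≫ sigmaProj M (s.image Discrete.as) = a := by
    refine Sigma.hom_ext _ _ fun x ↦ ?_
    have : Sigma.ι (fun x : s ↦ (Discrete.functor M).obj x) x ≫ a = Sigma.ι M x.1.as :=
      colimit.ι_desc _ _
    rw [← Category.assoc, this]
    exact ι_sigmaProj_of_mem (Finset.mem_image_of_mem _ x.2)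
  change ((r ≫ f) ≫ w) ≫ _ = (r ≫ f) ≫ w
  rw [Category.assoc r, ← h₁, Category.assoc, h₂]

end LocalTopology

/-! ### Local generation and local relations by compact objects -/

section FactorSieve

variable {T : Type u} [Category.{v} T] [Preadditive T] [HasCoproducts.{v} T]
  {A : Type*} [Category.{v} A] (H : T ⥤ A)

/-- For a predicate `K` on morphisms to `X`, the sieve of those morphisms whose composition with
`w : W ⟶ H X` factors through `H k` for some `k` in `K` whose domain is finitary. -/
def factorSieve {X : T} (K : ∀ ⦃C : T⦄, (C ⟶ X) → Prop) {W : A} (w : W ⟶ H.obj X) :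
    Sieve W where
  arrows V g := ∃ (C : T) (k : C ⟶ X) (x : V ⟶ H.obj C), IsFinitary C ∧ K k ∧ g ≫ w = x ≫ H.map k
  downward_closed := by
    rintro V V' g ⟨C, k, x, hC, hk, h⟩ g'
    exact ⟨C, k, g' ≫ x, hC, hk, by rw [Category.assoc, h, Category.assoc]⟩

variable [Abelian A]

/-- `H X` is locally generated by the images of `H C` for `C` finitary. -/
def LocallyGenerated (X : T) : Prop :=
  ∀ ⦃W : A⦄ (w : W ⟶ H.obj X), factorSieve H (fun _ _ ↦ True) w ∈ localTopology A W

/-- The kernel of `H C ⟶ H X`, for `C` finitary, is locally generated by the images of `H D` for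
those `D ⟶ C` with `D` finitary such that the composition `D ⟶ X` is zero. -/
def LocallyRelated (X : T) : Prop :=
  ∀ ⦃D : T⦄ (φ : D ⟶ X), IsFinitary D → ∀ ⦃W : A⦄ (w : W ⟶ H.obj D), w ≫ H.map φ = 0 →
    factorSieve H (fun _ k ↦ k ≫ φ = 0) w ∈ localTopology A W

variable {H}

lemma factorSieve_pullback {A : Type*} [Category.{v} A] {H : T ⥤ A} {X : T}
    (K : ∀ ⦃C : T⦄, (C ⟶ X) → Prop) {W V : A} (g : V ⟶ W)
    (w : W ⟶ H.obj X) : (factorSieve H K w).pullback g = factorSieve H K (g ≫ w) := by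
  ext U f
  change (∃ C k x, _ ∧ _ ∧ (f ≫ g) ≫ w = _) ↔ ∃ C k x, _ ∧ _ ∧ f ≫ g ≫ w = _
  simp only [Category.assoc]

lemma factorSieve_mem_of_exists {X : T} {K : ∀ ⦃C : T⦄, (C ⟶ X) → Prop} {W : A}
    {w : W ⟶ H.obj X} {C : T} (hC : IsFinitary C) (k : C ⟶ X) (x : W ⟶ H.obj C) (hk : K k)
    (h : w = x ≫ H.map k) : factorSieve H K w ∈ localTopology A W := by
  convert (localTopology A).top_mem W
  rw [← Sieve.id_mem_iff_eq_top]
  exact ⟨C, k, x, hC, hk, by rw [Category.id_comp, h]⟩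

lemma factorSieve_mem_of_epi {X : T} {K : ∀ ⦃C : T⦄, (C ⟶ X) → Prop} {W W' : A} (π : W' ⟶ W)
    [Epi π] {w : W ⟶ H.obj X} (h : factorSieve H K (π ≫ w) ∈ localTopology A W') :
    factorSieve H K w ∈ localTopology A W :=
  mem_localTopology_of_pullback_epi π (by rwa [factorSieve_pullback])

lemma factorSieve_mem_of_cover {X : T} {K : ∀ ⦃C : T⦄, (C ⟶ X) → Prop} {W : A} {S : Sieve W}
    (hS : S ∈ localTopology A W) {w : W ⟶ H.obj X}
    (h : ∀ ⦃V : A⦄ (g : V ⟶ W), S g → factorSieve H K (g ≫ w) ∈ localTopology A V) :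
    factorSieve H K w ∈ localTopology A W :=
  (localTopology A).transitive hS _ fun V g hg ↦ by
    rw [factorSieve_pullback]
    exact h g hg

lemma factorSieve_mem_trans {X : T} {K K' : ∀ ⦃C : T⦄, (C ⟶ X) → Prop} {W : A}
    {w : W ⟶ H.obj X} (hK : factorSieve H K w ∈ localTopology A W)
    (h : ∀ ⦃C : T⦄ (k : C ⟶ X), IsFinitary C → K k → ∀ ⦃V : A⦄ (g : V ⟶ W) (x : V ⟶ H.obj C),
      g ≫ w = x ≫ H.map k → factorSieve H (fun _ l ↦ K' (l ≫ k)) x ∈ localTopology A V) :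
    factorSieve H K' w ∈ localTopology A W := by
  refine factorSieve_mem_of_cover hK ?_
  rintro V g ⟨C, k, x, hC, hk, hx⟩
  rw [hx]
  refine (localTopology A).superset_covering ?_ (h k hC hk g x hx)
  rintro U f ⟨D, l, y, hD, hl, hy⟩
  exact ⟨D, l ≫ k, y, hD, hl, by rw [H.map_comp, ← Category.assoc, hy, Category.assoc]⟩

lemma factorSieve_mem_map {X Y : T} {W : A} {w : W ⟶ H.obj X} (f : X ⟶ Y)
    (h : factorSieve H (fun _ _ ↦ True) w ∈ localTopology A W) :
    factorSieve H (fun _ _ ↦ True) (w ≫ H.map f) ∈ localTopology A W := by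
  refine (localTopology A).superset_covering ?_ h
  rintro U g ⟨D, l, y, hD, -, hy⟩
  exact ⟨D, l ≫ f, y, hD, trivial, by rw [← Category.assoc, hy, Category.assoc, H.map_comp]⟩

lemma LocallyGenerated.of_iso {X Y : T} (h : LocallyGenerated H X) (e : X ≅ Y) :
    LocallyGenerated H Y := fun W w ↦ by
  have := factorSieve_mem_map e.hom (h (w ≫ H.map e.inv))
  rwa [Category.assoc, ← H.map_comp, e.inv_hom_id, H.map_id, Category.comp_id] at this

lemma LocallyRelated.of_iso {X Y : T} (h : LocallyRelated H X) (e : X ≅ Y) :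
    LocallyRelated H Y := fun D φ hD W w hw ↦ by
  have := h (φ ≫ e.inv) hD w (by rw [H.map_comp, ← Category.assoc, hw, zero_comp])
  simpa only [← Category.assoc, Preadditive.IsIso.comp_right_eq_zero] using this

lemma locallyGenerated_of_isFinitary {X : T} (hX : IsFinitary X) : LocallyGenerated H X :=
  fun W w ↦ factorSieve_mem_of_exists hX (𝟙 X) w trivial (by rw [H.map_id, Category.comp_id])

lemma LocallyRelated.sigma {J : Type v} {X : J → T} (hX : ∀ j, LocallyRelated H (X j)) :
    LocallyRelated H (∐ X) := by
  -- Components are killed one index at a time, refining the compact source at each step; a finite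
  -- set suffices because `φ` comes from a finitary object.
  have key (s : Finset J) : ∀ ⦃D : T⦄ (φ : D ⟶ ∐ X), IsFinitary D → ∀ ⦃W : A⦄ (w : W ⟶ H.obj D),
      (∀ j ∈ s, w ≫ H.map (φ ≫ Sigma.π X j) = 0) →
      factorSieve H (fun _ k ↦ ∀ j ∈ s, k ≫ φ ≫ Sigma.π X j = 0) w ∈ localTopology A W := by
    induction s using Finset.induction_on with
    | empty =>
      intro D φ hD W w _
      exact factorSieve_mem_of_exists hD (𝟙 D) w (by simp) (by simp)
    | insert m s hm ih =>
      intro D φ hD W w hw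
      refine factorSieve_mem_trans (hX m _ hD w (hw m (Finset.mem_insert_self m s))) ?_
      intro C k hC hk V g x hx
      refine (localTopology A).superset_covering ?_ (ih (k ≫ φ) hC x fun j hj ↦ ?_)
      · rintro U f ⟨E, l, y, hE, hl, hy⟩
        refine ⟨E, l, y, hE, fun j hj ↦ ?_, hy⟩
        rcases Finset.mem_insert.1 hj with rfl | hj
        · rw [Category.assoc, hk, comp_zero]
        · simpa using hl j hj
      · rw [Category.assoc, H.map_comp, ← Category.assoc, ← hx, Category.assoc,
          hw j (Finset.mem_insert_of_mem hj), comp_zero]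
  intro D φ hD W w hw
  obtain ⟨s, hs⟩ := hD _ _ φ
  refine (localTopology A).superset_covering ?_ (key s φ hD w fun j _ ↦ ?_)
  · rintro U f ⟨E, l, y, hE, hl, hy⟩
    refine ⟨E, l, y, hE, ?_, hy⟩
    change l ≫ φ = 0
    rw [eq_sum_of_comp_sigmaProj (comp_sigmaProj_eq_self_of_comp (g := l) hs)]
    exact Finset.sum_eq_zero fun j hj ↦ by rw [Category.assoc l, hl j hj, zero_comp]
  · rw [H.map_comp, ← Category.assoc, hw, zero_comp]

end FactorSieve

section Homological

variable {T : Type u} [Category.{v} T] [Preadditive T] [HasZeroObject T] [HasShift T ℤ]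
  [∀ n : ℤ, (shiftFunctor T n).Additive] [Pretriangulated T]
  {A : Type*} [Category.{v} A] [Abelian A] {H : T ⥤ A}

lemma exists_epi_lift [H.IsHomological] {X Y Z : T} {f : X ⟶ Y} {g : Y ⟶ Z} {h : Z ⟶ X⟦(1 : ℤ)⟧}
    (hD : Triangle.mk f g h ∈ distTriang T) {W : A} (w : W ⟶ H.obj Y) (hw : w ≫ H.map g = 0) :
    ∃ (W' : A) (π : W' ⟶ W) (_ : Epi π) (x : W' ⟶ H.obj X), π ≫ w = x ≫ H.map f :=
  (H.map_distinguished_exact _ hD).exact_up_to_refinements w hw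

variable [HasCoproducts.{v} T]

lemma factorSieve_add_mem [H.Additive] {X : T} {W : A} {w w' : W ⟶ H.obj X}
    (h : factorSieve H (fun _ _ ↦ True) w ∈ localTopology A W)
    (h' : factorSieve H (fun _ _ ↦ True) w' ∈ localTopology A W) :
    factorSieve H (fun _ _ ↦ True) (w + w') ∈ localTopology A W := by
  refine (localTopology A).superset_covering ?_ ((localTopology A).intersection_covering h h')
  rintro V g ⟨⟨C, k, x, hC, -, hx⟩, ⟨C', k', x', hC', -, hx'⟩⟩
  refine ⟨C ⊞ C', biprod.desc k k', x ≫ H.map biprod.inl + x' ≫ H.map biprod.inr,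
    hC.biprod hC', trivial, ?_⟩
  rw [Preadditive.comp_add, hx, hx', Preadditive.add_comp, Category.assoc, Category.assoc,
    ← H.map_comp, ← H.map_comp, biprod.inl_desc, biprod.inr_desc]

variable [H.IsHomological]

lemma locallyRelated_of_isFinitary {X : T} (hX : IsFinitary X) : LocallyRelated H X := by
  intro D φ hD W w hw
  obtain ⟨C, k, d, h⟩ := distinguished_cocone_triangle₁ φ
  obtain ⟨W', π, _, x, hx⟩ := exists_epi_lift h w hw
  exact factorSieve_mem_of_epi π
    (factorSieve_mem_of_exists (IsFinitary.fiber h hD hX) k x (distTriang_comp₁₂ h) hx)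

/-- A section `z` of `H Z` has its image in `H (X⟦1⟧)` locally coming from a compact object. After
refinement by the relations of `Y⟦1⟧` the corresponding map lifts to some `ψ` into `Z`. Subtracting
its contribution leaves a section coming from `H Y`, which is locally generated. -/
lemma LocallyGenerated.cone {X Y Z : T} {f : X ⟶ Y} {g : Y ⟶ Z} {h : Z ⟶ X⟦(1 : ℤ)⟧}
    (hD : Triangle.mk f g h ∈ distTriang T) (hX : LocallyGenerated H (X⟦(1 : ℤ)⟧))
    (hY : LocallyGenerated H Y) (hY' : LocallyRelated H (Y⟦(1 : ℤ)⟧)) :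
    LocallyGenerated H Z := by
  intro W z
  refine factorSieve_mem_of_cover (hX (z ≫ H.map h)) ?_
  rintro V a ⟨C, φ, c, hC, -, hc⟩
  have h₁ : c ≫ H.map (φ ≫ f⟦(1 : ℤ)⟧') = 0 := by
    rw [H.map_comp, ← Category.assoc, ← hc, Category.assoc, Category.assoc, ← H.map_comp,
      distTriang_comp₃₁ hD, H.map_zero, comp_zero, comp_zero]
  refine factorSieve_mem_of_cover (hY' _ hC c h₁) ?_
  rintro V' b ⟨C', k, c', hC', hk, hc'⟩
  obtain ⟨ψ, hψ⟩ := distTriang_lift₁ hD (k ≫ φ) (by rw [Category.assoc, hk])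
  obtain ⟨V'', π, _, y, hy⟩ := exists_epi_lift (distTriang_rotate hD)
    (b ≫ a ≫ z - c' ≫ H.map ψ) (by
      rw [Preadditive.sub_comp, Category.assoc, Category.assoc, hc, Category.assoc, ← H.map_comp,
        ← hψ, ← Category.assoc, hc', Category.assoc, H.map_comp, sub_self])
  refine factorSieve_mem_of_epi π ?_
  have h₂ : π ≫ b ≫ a ≫ z = y ≫ H.map g + (π ≫ c') ≫ H.map ψ := by
    rw [← hy, Preadditive.comp_sub, Category.assoc π, sub_add_cancel]
  rw [h₂]
  exact factorSieve_add_mem (factorSieve_mem_map g (hY y))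
    (factorSieve_mem_of_exists hC' ψ (π ≫ c') trivial rfl)

lemma LocallyRelated.cone {X Y Z : T} {f : X ⟶ Y} {g : Y ⟶ Z} {h : Z ⟶ X⟦(1 : ℤ)⟧}
    (hD : Triangle.mk f g h ∈ distTriang T) (hX : LocallyGenerated H X)
    (hX' : LocallyRelated H (X⟦(1 : ℤ)⟧)) (hY : LocallyRelated H Y) :
    LocallyRelated H Z := by
  intro D φ hD' W w hw
  have h₁ : w ≫ H.map (φ ≫ h) = 0 := by rw [H.map_comp, ← Category.assoc, hw, zero_comp]
  refine factorSieve_mem_trans (hX' _ hD' w h₁) ?_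
  intro C k hC hk V a x hx
  obtain ⟨ψ, hψ⟩ := distTriang_lift₃ hD (k ≫ φ) (by rw [Category.assoc, hk])
  obtain ⟨V', π, _, y, hy⟩ := exists_epi_lift hD (x ≫ H.map ψ) (by
    rw [Category.assoc, ← H.map_comp, ← hψ, H.map_comp, ← Category.assoc, ← hx, Category.assoc,
      hw, comp_zero])
  refine factorSieve_mem_of_epi π (factorSieve_mem_of_cover (hX y) ?_)
  rintro V'' b ⟨C', χ, x', hC', -, hx'⟩
  -- The two local descriptions of the same section of `H Y`, through `ψ` and through `χ ≫ f`, give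
  -- one relation on `C ⊞ C'`, to which the hypothesis on `Y` applies.
  have h₂ : ((b ≫ π ≫ x) ≫ H.map biprod.inl + x' ≫ H.map biprod.inr) ≫
      H.map (biprod.desc ψ (-(χ ≫ f))) = 0 := by
    rw [Preadditive.add_comp, Category.assoc, Category.assoc x', ← H.map_comp, ← H.map_comp,
      biprod.inl_desc, biprod.inr_desc, H.map_neg, Preadditive.comp_neg, Category.assoc b,
      Category.assoc π, hy, H.map_comp, ← Category.assoc b, hx', Category.assoc, add_neg_cancel]
  refine (localTopology A).superset_covering ?_ (hY _ (hC.biprod hC') _ h₂)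
  rintro U d ⟨E, l, z, hE, hl, hz⟩
  refine ⟨E, l ≫ biprod.fst, z, hE, ?_, ?_⟩
  · rw [biprod.desc_eq, Preadditive.comp_add, Preadditive.comp_neg, Preadditive.comp_neg,
      ← sub_eq_add_neg, sub_eq_zero] at hl
    rw [Category.assoc (l ≫ biprod.fst), hψ, Category.assoc, ← Category.assoc biprod.fst,
      ← Category.assoc l, hl, Category.assoc,
      Category.assoc, Category.assoc, distTriang_comp₁₂ hD, comp_zero, comp_zero, comp_zero]
  · rw [H.map_comp, ← Category.assoc z, ← hz, Category.assoc d, Preadditive.add_comp,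
      Category.assoc, Category.assoc x', ← H.map_comp, ← H.map_comp, biprod.inl_fst,
      biprod.inr_fst, H.map_id, H.map_zero, comp_zero, add_zero, Category.comp_id]

lemma LocallyGenerated.sigma [HasColimitsOfSize.{v, v} A] [AB5 A] {J : Type v}
    [PreservesColimitsOfShape (Discrete J) H] {X : J → T} (hX : ∀ j, LocallyGenerated H (X j)) :
    LocallyGenerated H (∐ X) := by
  intro W w
  refine factorSieve_mem_of_cover (finite_mem_localTopology (fun j ↦ H.obj (X j))
    (w ≫ inv (sigmaComparison H X)) ⟨fun V g ↦ ∃ s, (g ≫ w ≫ inv (sigmaComparison H X)) ≫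
      sigmaProj _ s = g ≫ w ≫ inv (sigmaComparison H X), by
        rintro V V' g ⟨s, hs⟩ g'
        exact ⟨s, by rw [Category.assoc g', Category.assoc, hs]⟩⟩ fun V g s hs ↦ ⟨s, hs⟩) ?_
  rintro V g ⟨s, hs⟩
  have h₁ := eq_sum_of_comp_sigmaProj hs =≫ sigmaComparison H X
  rw [← Category.assoc g, Category.assoc (g ≫ w), IsIso.inv_hom_id, Category.comp_id,
    Preadditive.sum_comp] at h₁
  have h₂ : g ≫ w = ∑ j ∈ s, ((g ≫ w ≫ inv (sigmaComparison H X)) ≫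
      Sigma.π (fun j ↦ H.obj (X j)) j) ≫ H.map (Sigma.ι X j) :=
    h₁.trans (Finset.sum_congr rfl fun j _ ↦ by rw [Category.assoc _ _ (sigmaComparison H X),
      ι_comp_sigmaComparison, Category.assoc g])
  rw [h₂]
  clear hs h₁ h₂
  induction s using Finset.induction_on with
  | empty =>
    have h0 : IsFinitary (0 : T) := fun _ _ _ ↦ ⟨∅, (isZero_zero T).eq_of_src _ _⟩
    exact factorSieve_mem_of_exists h0 0 0 trivial (by simp)
  | insert j s hj ih =>
    rw [Finset.sum_insert hj]
    exact factorSieve_add_mem (factorSieve_mem_map _ (hX j _)) ih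

end Homological

/-! ### Suspensions, Brown functors from injectives, and the step from (1) to (2) -/

section Shift

variable {T : Type u} [Category.{v} T] [HasShift T ℤ]

lemma shift_isSuspensionStable (Y : T) :
    IsSuspensionStable fun n : ULift.{t} ℤ ↦ Y⟦n.down⟧ :=
  fun k n ↦ ⟨⟨k.down + n⟩, ⟨(shiftFunctorAdd T k.down n).app Y⟩⟩

variable [Preadditive T] [∀ n : ℤ, (shiftFunctor T n).Additive]

lemma forall_shift_hom_eq_zero_iff (X Y : T) (n m : ℤ) (hnm : n + m = 0) :
    (∀ f : X⟦m⟧ ⟶ Y, f = 0) ↔ ∀ f : X ⟶ Y⟦n⟧, f = 0 := by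
  let ε := shiftFunctorCompIsoId T n (m) hnm
  let ε' := shiftFunctorCompIsoId T (m) n (by lia)
  constructor
  · intro h f
    have h0 := h (f⟦m⟧' ≫ ε.hom.app Y)
    rw [Preadditive.IsIso.comp_right_eq_zero] at h0
    exact (shiftFunctor T (m)).map_injective (h0.trans (Functor.map_zero _ _ _).symm)
  · intro h f
    have h0 := h (ε'.inv.app X ≫ f⟦n⟧')
    rw [Preadditive.IsIso.comp_left_eq_zero] at h0
    refine (shiftFunctor T n).map_injective ?_
    rw [Functor.map_zero]
    exact h0

variable [HasCoproducts.{v} T]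

lemma IsPureInjective.shift {Y : T} (hY : IsPureInjective Y) (n : ℤ) :
    IsPureInjective (Y⟦n⟧) := by
  intro X f hf
  let ε := shiftFunctorCompIsoId T n (-n) (add_neg_cancel n)
  let ε' := shiftFunctorCompIsoId T (-n) n (neg_add_cancel n)
  have hp : IsPureMono (ε.inv.app Y ≫ f⟦-n⟧') := by
    refine (isPureMono_iff _).2 fun C hC φ hφ ↦ ?_
    have h₁ := (isPureMono_iff f).1 hf _ (hC.shift n) (φ⟦n⟧' ≫ (ε.inv.app Y)⟦n⟧' ≫ ε'.hom.app _) (by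
      have := ε'.hom.naturality f
      dsimp at this
      rw [Category.assoc, Category.assoc, ← this, ← Functor.map_comp_assoc,
        ← Functor.map_comp_assoc, Category.assoc, hφ, Functor.map_zero, zero_comp])
    rw [Preadditive.IsIso.comp_right_eq_zero] at h₁
    exact (shiftFunctor T n).map_injective (h₁.trans (Functor.map_zero _ _ _).symm)
  obtain ⟨⟨r, hr⟩⟩ := hY _ hp
  have h₂ : f⟦-n⟧' ≫ r = ε.hom.app Y := by
    rwa [← cancel_epi (ε.inv.app Y), Iso.inv_hom_id_app, ← Category.assoc]
  have h₃ : f ≫ ε'.inv.app X ≫ r⟦n⟧' = ε'.inv.app (Y⟦n⟧) ≫ (ε.hom.app Y)⟦n⟧' := by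
    have := ε'.inv.naturality f
    dsimp at this
    rw [← h₂, Functor.map_comp, ← Category.assoc, this, Category.assoc]
  have : IsIso (f ≫ ε'.inv.app X ≫ r⟦n⟧') := by
    rw [h₃]
    infer_instance
  have : IsSplitMono (f ≫ ε'.inv.app X ≫ r⟦n⟧') := inferInstance
  exact ⟨⟨(ε'.inv.app X ≫ r⟦n⟧') ≫ retraction (f ≫ ε'.inv.app X ≫ r⟦n⟧'), by
    rw [← Category.assoc, IsSplitMono.id]⟩⟩

end Shift

variable {T : Type u} [Category.{v} T] [Preadditive T] [HasZeroObject T] [HasShift T ℤ]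
  [∀ n : ℤ, (shiftFunctor T n).Additive] [Pretriangulated T] [HasCoproducts.{v} T]

section Homological

variable {A : Type*} [Category.{v} A] [Abelian A] [HasColimitsOfSize.{v, v} A] {H : T ⥤ A}
  [H.IsHomological]

lemma isBrownFunctor_of_injective (hH : ∀ J : Type v, PreservesColimitsOfShape (Discrete J) H)
    (E : A) [Injective E] : IsBrownFunctor (H.op ⋙ preadditiveYoneda.obj E) where
  additive := inferInstance
  exact {X Y Z f g h} hD (y : H.obj Y ⟶ E) (hy : H.map f ≫ y = 0) :=
    ⟨(H.map_distinguished_exact _ hD).descToInjective y hy,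
      (H.map_distinguished_exact _ hD).comp_descToInjective y hy⟩
  exists_lift J X x := by
    have := hH J
    let x' (j : J) : H.obj (X j) ⟶ E := x j
    refine ⟨(inv (sigmaComparison H X) ≫ Sigma.desc x' :), fun j ↦ ?_⟩
    change H.map (Sigma.ι X j) ≫ inv (sigmaComparison H X) ≫ Sigma.desc x' = x' j
    rw [← ι_comp_sigmaComparison, Category.assoc, IsIso.hom_inv_id_assoc, Sigma.ι_desc]
  hom_ext J X (y : H.obj (∐ X) ⟶ E) (hy : ∀ j, H.map (Sigma.ι X j) ≫ y = 0) := by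
    have := hH J
    change y = 0
    rw [← cancel_epi (sigmaComparison H X), comp_zero]
    refine Sigma.hom_ext _ _ fun j ↦ ?_
    rw [← Category.assoc, ι_comp_sigmaComparison, hy j, comp_zero]

variable [AB5 A] {C : Type v} [SmallCategory C] {i : C ⥤ T}

theorem IsCompactModel.locallyGenerated_and_locallyRelated (hi : IsCompactModel i)
    (hH : ∀ J : Type v, PreservesColimitsOfShape (Discrete J) H) (X : T) :
    LocallyGenerated H X ∧ LocallyRelated H X := by
  -- All shifts are carried along because the cone lemmas for `Z` also use `X⟦1⟧` and `Y⟦1⟧`.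
  let P : ObjectProperty T := fun X ↦
    ∀ n : ℤ, LocallyGenerated H (X⟦n⟧) ∧ LocallyRelated H (X⟦n⟧)
  have : P.IsClosedUnderIsomorphisms := ⟨fun e h n ↦
    ⟨(h n).1.of_iso ((shiftFunctor T n).mapIso e), (h n).2.of_iso ((shiftFunctor T n).mapIso e)⟩⟩
  have hP : IsClosedUnderCoproductsAndCones P := by
    refine ⟨fun J X hX n ↦ ?_, fun {X Y Z f g h} hD hX hY n ↦ ?_⟩
    · have := hH J
      let e := asIso (sigmaComparison (shiftFunctor T n) X)
      exact ⟨(LocallyGenerated.sigma fun j ↦ (hX j n).1).of_iso e,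
        (LocallyRelated.sigma fun j ↦ (hX j n).2).of_iso e⟩
    · have hD' := Triangle.shift_distinguished _ hD n
      let e (W : T) : W⟦n + 1⟧ ≅ W⟦n⟧⟦(1 : ℤ)⟧ := (shiftFunctorAdd' T n 1 (n + 1) rfl).app W
      exact ⟨.cone hD' ((hX (n + 1)).1.of_iso (e X)) (hY n).1 ((hY (n + 1)).2.of_iso (e Y)),
        .cone hD' (hX n).1 ((hX (n + 1)).2.of_iso (e X)) (hY n).2⟩
  have h := hi.prop_of_closed (P := P) hP (fun c n ↦
    ⟨locallyGenerated_of_isFinitary ((hi.isFinitary c).shift n),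
      locallyRelated_of_isFinitary ((hi.isFinitary c).shift n)⟩) X 0
  exact ⟨h.1.of_iso ((shiftFunctorZero T ℤ).app X), h.2.of_iso ((shiftFunctorZero T ℤ).app X)⟩

/-- A covering annihilator of `φ` forces `H φ = 0`, and local generation turns this into `H X = 0`.
Conversely, if `H X = 0` then all of `H (i d)` is a relation, so by local relations the annihilators
cover. -/
lemma IsCompactModel.isZero_homSheaf_obj_iff_of_isHomological [i.Full] (hi : IsCompactModel i)
    (hH : ∀ J : Type v, PreservesColimitsOfShape (Discrete J) H) (X : T) :
    IsZero ((homSheaf i (denseTopology (i ⋙ H) ⊤)).obj X) ↔ IsZero (H.obj X) := by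
  obtain ⟨hX, hX'⟩ := hi.locallyGenerated_and_locallyRelated hH X
  rw [isZero_homSheaf_obj_iff]
  constructor
  · intro h
    refine (IsZero.iff_id_eq_zero _).2 (eq_zero_of_mem_localTopology (hX (𝟙 _)) _ ?_)
    rintro V g ⟨D, k, x, hD, -, hx⟩
    obtain ⟨c, ⟨e⟩⟩ := hi.exists_iso D hD
    have hk : H.map (e.hom ≫ k) = 0 := by
      refine h c (e.hom ≫ k) (𝟙 c) trivial (H.map (e.hom ≫ k)) fun d g hg ↦ ?_
      rw [Category.comp_id] at hg
      change H.map (i.map g) ≫ _ = 0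
      rw [← H.map_comp]
      exact (congrArg H.map hg).trans (H.map_zero _ _)
    rw [H.map_comp, Preadditive.IsIso.comp_left_eq_zero] at hk
    rw [hx, hk, comp_zero]
  · intro h c φ d f Z _ q hq
    refine eq_zero_of_mem_localTopology
      (hX' (i.map f ≫ φ) (hi.isFinitary d) (𝟙 _) (h.eq_of_tgt _ _)) q ?_
    rintro V g ⟨D, k, x, hD, hk, hx⟩
    obtain ⟨c', ⟨e⟩⟩ := hi.exists_iso D hD
    have hk' : k ≫ i.map f ≫ φ = 0 := hk
    obtain ⟨l, hl⟩ := i.map_surjective (e.hom ≫ k)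
    have h₁ : H.map (e.hom ≫ k) ≫ q = 0 := by
      rw [← hl]
      refine hq l ?_
      change i.map (l ≫ f) ≫ φ = 0
      rw [i.map_comp, hl, Category.assoc, Category.assoc, hk', comp_zero]
    rw [H.map_comp, Category.assoc, Preadditive.IsIso.comp_left_eq_zero] at h₁
    rw [Category.comp_id] at hx
    exact (congrArg (· ≫ q) hx).trans ((Category.assoc _ _ _).trans (by rw [h₁, comp_zero]))

end Homological

theorem exists_isPureInjective_of_isHomological (hT : IsCompactlyGenerated T) {A : Type*}
    [Category.{v} A] [Abelian A] [HasColimitsOfSize.{v, v} A] [AB5 A] (H : T ⥤ A)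
    [H.IsHomological] (hH : ∀ J : Type v, PreservesColimitsOfShape (Discrete J) H) :
    ∃ Y : T, IsPureInjective Y ∧ ∀ X, IsZero (H.obj X) ↔ ∀ f : X ⟶ Y, f = 0 := by
  obtain ⟨C, _, i, _, hi⟩ := hT.exists_isCompactModel
  let J := denseTopology (i ⋙ H) ⊤
  let G := homSheaf i J
  have : HasColimitsOfSize.{v, v} (Sheaf J AddCommGrpCat.{v}) := ⟨fun _ _ ↦ inferInstance⟩
  -- Smallness of `C` supplies a separator of the sheaf category, and hence an injective
  -- coseparator.
  obtain ⟨E, _, hE⟩ := Abelian.has_injective_coseparator (separator (Sheaf J AddCommGrpCat.{v}))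
    (isSeparator_separator _)
  obtain ⟨Y, (y : G.obj Y ⟶ E), hy⟩ := (isBrownFunctor_of_injective (H := G)
    (preservesCoproducts_homSheaf i J
      fun c ↦ compactObjects_of_isFinitary (hi.isFinitary c)) E).exists_representation hi
  have hy' (Z : T) : Function.Bijective fun φ : Z ⟶ Y ↦ G.map φ ≫ y := hy Z
  refine ⟨Y, fun X f hf ↦ ?_, fun X ↦ ?_⟩
  · have : Mono (G.map f) := mono_homSheaf_map i J f fun c φ hφ ↦
      (isPureMono_iff f).1 hf _ (hi.isFinitary c) φ hφ
    -- The universal element `y` extends along the monomorphism `G f`; the map `r` representing the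
    -- extension is a retraction of `f`.
    obtain ⟨r, hr⟩ := (hy' X).2 (Injective.factorThru y (G.map f))
    refine ⟨⟨r, (hy' Y).1 ?_⟩⟩
    change G.map (f ≫ r) ≫ y = G.map (𝟙 Y) ≫ y
    have hr' : G.map r ≫ y = Injective.factorThru y (G.map f) := hr
    rw [G.map_comp, Category.assoc, hr', Injective.comp_factorThru, G.map_id, Category.id_comp]
  · rw [← hi.isZero_homSheaf_obj_iff_of_isHomological hH]
    refine ⟨fun h f ↦ (hy' X).1 (IsZero.eq_of_src h _ _), fun h ↦ (IsZero.iff_id_eq_zero _).2 ?_⟩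
    refine hE.def _ _ fun q ↦ ?_
    obtain ⟨f, hf⟩ := (hy' X).2 q
    have hf' : G.map f ≫ y = q := hf
    change 𝟙 (G.obj X) ≫ q = 0 ≫ q
    rw [← hf', h f, G.map_zero, zero_comp, comp_zero, comp_zero]

lemma exists_isPureInjective_of_isCohomological (hT : IsCompactlyGenerated T)
    (L : ObjectProperty T) (hL : IsCohomological.{w} L) :
    ∃ (I : Type t) (Y : I → T), IsSuspensionStable Y ∧ (∀ i, IsPureInjective (Y i)) ∧
      ∀ X : T, L X ↔ ∀ (i : I) (f : X ⟶ Y i), f = 0 := by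
  obtain ⟨A, _, _, _, _, H, _, hH, hL⟩ := hL
  obtain ⟨Y, hY, hYH⟩ := exists_isPureInjective_of_isHomological hT H hH
  refine ⟨ULift.{t} ℤ, fun n ↦ Y⟦n.down⟧, shift_isSuspensionStable Y, fun n ↦ hY.shift _,
    fun X ↦ ?_⟩
  have h (n m : ℤ) (hnm : n + m = 0) :
      IsZero (H.obj (X⟦m⟧)) ↔ ∀ f : X ⟶ Y⟦n⟧, f = 0 :=
    (hYH _).trans (forall_shift_hom_eq_zero_iff X Y n m hnm)
  rw [hL]
  exact ⟨fun hX n ↦ (h _ _ (add_neg_cancel n.down)).1 (hX _),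
    fun hX n ↦ (h _ _ (neg_add_cancel n)).2 (hX ⟨-n⟩)⟩

end TriangulatedPurity

end

theorem mainTheorem8 (T : Type u) [Category.{v} T] [Preadditive T] [HasZeroObject T]
    [HasShift T ℤ] [∀ n : ℤ, (shiftFunctor T n).Additive] [Pretriangulated T]
    [IsTriangulated T] (hT : TriangulatedPurity.IsCompactlyGenerated T)
    (L : ObjectProperty T) (hL : TriangulatedPurity.IsLocalizing L) :
    TriangulatedPurity.IsCohomological.{w} L ↔
      ∃ (I : Type t) (Y : I → T),
        TriangulatedPurity.IsSuspensionStable Y ∧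
        (∀ i, TriangulatedPurity.IsPureInjective (Y i)) ∧
        ∀ X : T, L X ↔ ∀ (i : I) (f : X ⟶ Y i), f = 0 := by
  have := hT.hasCoproducts
  refine ⟨TriangulatedPurity.exists_isPureInjective_of_isCohomological hT L, ?_⟩
  rintro ⟨I, Y, hs, hY, h⟩
  exact TriangulatedPurity.isCohomological_of_isPureInjective hT L Y hs hY h
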